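/- Let $M$ be a von Neumann algebra with a faithful normal trace state $\tau$, let $1 \in B \subset M$ be a W$^*$-subalgebra, let $X = X^* \in M$, and let $p \in M$ be a nonzero projection which commutes with $B$. Write $B[p]$ for the algebra generated by $B$ and $p$, put $\alpha = \tau(p)$ and $X_p = \alpha^{-1} pXp \in pMp$, and equip $pMp$ (with unit $p$) with the faithful normal trace state $\tau_p = \alpha^{-1}\tau|_{pMp}$. For a W$^*$-probability space $(N,\varphi)$, a unital $*$-subalgebra $A \subset N$ and $Y = Y^* \in N$ algebraically free from $A$, let $\partial_{Y:A} : A\langle Y\rangle \to A\langle Y\rangle \otimes A\langle Y\rangle$ be the derivation with $\partial_{Y:A}(a) = 0$ for $a \in A$ and $\partial_{Y:A}(Y) = 1 \otimes 1$, where $A\langle Y\rangle$ is the algebra generated by $A$ and $Y$. The conjugate variable $\mathcal J(Y:A)$ is the unique element (if one exists) of $L^1(W^*(A\langle Y\rangle),\varphi)$ such that $\varphi(\mathcal J(Y:A)\,m) = (\varphi\otimes\varphi)(\partial_{Y:A}\, m)$ for all $m \in A\langle Y\rangle$. Assume that $X$ is algebraically free from $B[p]$, that $p$ and $B$ are independent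 with respect to $\tau$, and that $X$ and $p$ are $B$-free (free with amalgamation over $B$, with respect to the $\tau$-preserving conditional expectation $E_B$ of $M$ onto $B$). If the conjugate variable $\mathcal J(X:B)$ exists in $(M,\tau)$, then $X_p$ is algebraically free from $Bp$ and the conjugate variable $\mathcal J(X_p:Bp)$ exists in $(pMp,\tau_p)$. It is given by $$\mathcal J(X_p:Bp) = E^{(pMp)}_{Bp\langle X_p\rangle}\bigl(p\,\mathcal J(X:B)\,p\bigr),$$ where $E^{(pMp)}_{Bp\langle X_p\rangle}$ is the $\tau_p$-preserving conditional expectation onto $W^*(Bp\langle X_p\rangle)$, extended to $L^1(pMp,\tau_p)$. -/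

import Mathlib

open scoped TensorProduct

namespace FreeProb

noncomputable section

/-! ### Algebraic notions: `B⟨X⟩`, algebraic freeness, the free difference quotient -/

section Algebraic

variable {R : Type*} [Ring R] [Algebra ℂ R]

/-- `B⟨X⟩`: the algebra generated by `B` and `X`.  It is generated without adjoining the unit of
the ambient algebra, so that for `B` containing the unit `e` of a corner `eRe` it is the unital
subalgebra of `eRe` generated by `B` and `X`; for `1 ∈ B` it is the usual `B⟨X⟩`. -/
def polyAlg (B : Submodule ℂ R) (X : R) : NonUnitalSubalgebra ℂ R :=
  NonUnitalAlgebra.adjoin ℂ ((B : Set R) ∪ {X})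

theorem coeff_mem_polyAlg {B : Submodule ℂ R} {X b : R} (hb : b ∈ B) : b ∈ polyAlg B X :=
  NonUnitalAlgebra.subset_adjoin ℂ (Or.inl hb)

theorem var_mem_polyAlg (B : Submodule ℂ R) (X : R) : X ∈ polyAlg B X :=
  NonUnitalAlgebra.subset_adjoin ℂ (Or.inr rfl)

/-- The linear map `B^{⊗(n+1)} → R`, `b₀ ⊗ b₁ ⊗ ⋯ ⊗ bₙ ↦ b₀ X b₁ X ⋯ X bₙ`. -/
def monomialMap (B : Submodule ℂ R) (X : R) (n : ℕ) :
    (⨂[ℂ] _ : Fin (n + 1), B) →ₗ[ℂ] R :=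
  PiTensorProduct.lift
    ((MultilinearMap.mkPiAlgebraFin ℂ (n + 1) R).compLinearMap fun i =>
      if i = 0 then B.subtype else LinearMap.mulLeft ℂ X ∘ₗ B.subtype)

/-- `X` is algebraically free from `B`: the evaluation at `X` of noncommutative polynomials with
coefficients in `B`, `⨁ₙ B^{⊗(n+1)} = B⟨t⟩ → R`, is injective. -/
def AlgebraicallyFree (B : Submodule ℂ R) (X : R) : Prop :=
  Function.Injective (DirectSum.toModule ℂ ℕ R (monomialMap B X))

/-- `D` is the free difference quotient `∂_{X:B} : B⟨X⟩ → B⟨X⟩ ⊗ B⟨X⟩`, where `e ∈ B` is the unit: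
the derivation with `D b = 0` for `b ∈ B` and `D X = e ⊗ e`. -/
structure IsFreeDifferenceQuotient (e : R) (B : Submodule ℂ R) (X : R)
    (D : polyAlg B X →ₗ[ℂ] polyAlg B X ⊗[ℂ] polyAlg B X) : Prop where
  leibniz : ∀ a b : polyAlg B X,
    D (a * b) = (LinearMap.mulRight ℂ b).lTensor (polyAlg B X) (D a)
      + (LinearMap.mulLeft ℂ a).rTensor (polyAlg B X) (D b)
  map_coeff : ∀ b (hb : b ∈ B), D ⟨b, coeff_mem_polyAlg hb⟩ = 0
  map_var : ∃ he : e ∈ B, D ⟨X, var_mem_polyAlg B X⟩ =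
    (⟨e, coeff_mem_polyAlg he⟩ : polyAlg B X) ⊗ₜ[ℂ] (⟨e, coeff_mem_polyAlg he⟩ : polyAlg B X)

theorem IsFreeDifferenceQuotient.unique {e : R} {B : Submodule ℂ R} {X : R}
    {D D' : polyAlg B X →ₗ[ℂ] polyAlg B X ⊗[ℂ] polyAlg B X}
    (h : IsFreeDifferenceQuotient e B X D) (h' : IsFreeDifferenceQuotient e B X D') : D = D' := by
  have key : ∀ x (hx : x ∈ polyAlg B X), D ⟨x, hx⟩ = D' ⟨x, hx⟩ := by
    intro x hx
    induction hx using NonUnitalAlgebra.adjoin_induction with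
    | mem y hy =>
      rcases hy with hy | hy
      · exact (h.map_coeff y hy).trans (h'.map_coeff y hy).symm
      · obtain rfl : y = X := hy
        obtain ⟨he, h1⟩ := h.map_var
        obtain ⟨he', h2⟩ := h'.map_var
        exact h1.trans h2.symm
    | add y z hy hz h1 h2 =>
      have e1 := D.map_add ⟨y, hy⟩ ⟨z, hz⟩
      have e2 := D'.map_add ⟨y, hy⟩ ⟨z, hz⟩
      rw [h1, h2, ← e2] at e1
      exact e1
    | zero => exact D.map_zero.trans D'.map_zero.symm
    | mul y z hy hz h1 h2 =>
      have e1 := h.leibniz ⟨y, hy⟩ ⟨z, hz⟩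
      have e2 := h'.leibniz ⟨y, hy⟩ ⟨z, hz⟩
      rw [h1, h2, ← e2] at e1
      exact e1
    | smul c y hy h1 =>
      have e1 := D.map_smul c ⟨y, hy⟩
      have e2 := D'.map_smul c ⟨y, hy⟩
      rw [h1, ← e2] at e1
      exact e1
  ext x
  exact key x.1 x.2

/-- `Bp`, as a linear subspace. -/
def rightMul (B : Submodule ℂ R) (p : R) : Submodule ℂ R :=
  B.map (LinearMap.mulRight ℂ p)

/-- The functional `φ ⊗ φ` on `B⟨X⟩ ⊗ B⟨X⟩`, for a linear functional `φ` on `R`. -/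
def tensorSquare (φ : R →ₗ[ℂ] ℂ) (P : NonUnitalSubalgebra ℂ R) : P ⊗[ℂ] P →ₗ[ℂ] ℂ :=
  LinearMap.mul' ℂ ℂ ∘ₗ
    TensorProduct.map (φ ∘ₗ P.toSubmodule.subtype) (φ ∘ₗ P.toSubmodule.subtype)

/-- The corner `eRe`, as a linear subspace. -/
def corner (e : R) : Submodule ℂ R :=
  LinearMap.range (LinearMap.mulLeft ℂ e ∘ₗ LinearMap.mulRight ℂ e)

theorem mem_corner_one (x : R) : x ∈ corner (1 : R) := ⟨x, by simp⟩

end Algebraic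

/-! ### The spaces `L¹(eRe)`, conditional expectations, freeness and independence -/

section Analytic

variable {R : Type*} [NormedRing R] [NormedAlgebra ℂ R]

/-- The functional `τ_e = τ(e)⁻¹ τ`, to be used on the corner `eRe`.  For `e = 1` and `τ 1 = 1`
this is `τ` itself. -/
def cornerTrace (τ : StrongDual ℂ R) (e : R) : StrongDual ℂ R := (τ e)⁻¹ • τ

/-- The map `x ↦ τ_e(x ·)` into the Banach dual of `eRe`.  For `x ∈ eRe` the dual norm of the image
is the norm `τ_e(|x|) = sup {|τ_e(x y)| : y ∈ eRe, ‖y‖ ≤ 1}` of `L¹(eRe, τ_e)`. -/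
def toL1 (τ : StrongDual ℂ R) (e : R) (x : R) : StrongDual ℂ (corner e) :=
  (cornerTrace τ e ∘L ContinuousLinearMap.mul ℂ R x) ∘L (corner e).subtypeL

@[simp] theorem toL1_apply (τ : StrongDual ℂ R) (e x : R) (y : corner e) :
    toL1 τ e x y = (τ e)⁻¹ * τ (x * y) := by
  simp [toL1, cornerTrace]

/-- `L¹(N) ⊆ L¹(eRe, τ_e)` for `N ⊆ eRe`: the completion of `N` in the norm
`‖x‖₁ = τ_e(|x|) = ‖τ_e(x ·)‖`, realized as the norm closure of `{τ_e(x ·) : x ∈ N}` in the Banach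
dual of `eRe`.  In this realization the value `ξ m` of `ξ ∈ L¹` at `m ∈ eRe` is `τ_e(ξ m)`. -/
def L1 (τ : StrongDual ℂ R) (e : R) (N : Set R) : Set (StrongDual ℂ (corner e)) :=
  closure (toL1 τ e '' N)

/-- The compression `ξ ↦ p ξ p` from `L¹(R, τ)` to `L¹(pRp, τ_p)`.  Since
`τ_p((p ξ p) m) = τ(p)⁻¹ τ(ξ m)` for `m ∈ pRp`, it is given by restricting the functional `τ(ξ ·)`
to `pRp` and dividing by `τ(p)`; see `compressL1_toL1`. -/
def compressL1 (τ : StrongDual ℂ R) (p : R) (ξ : StrongDual ℂ (corner (1 : R))) :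
    StrongDual ℂ (corner p) :=
  (τ p)⁻¹ • (ξ ∘L (corner p).subtypeL.codRestrict (corner 1) fun x => mem_corner_one x.1)

theorem continuous_compressL1 (τ : StrongDual ℂ R) (p : R) : Continuous (compressL1 τ p) := by
  unfold compressL1
  fun_prop

theorem compressL1_toL1 (τ : StrongDual ℂ R) (h1 : τ 1 = 1) (htr : ∀ x y, τ (x * y) = τ (y * x))
    (p x : R) (hp : p * p = p) :
    compressL1 τ p (toL1 τ 1 x) = toL1 τ p (p * x * p) := by
  ext ⟨y, z, rfl⟩
  have h : τ (x * (p * (z * p))) = τ (p * x * p * (p * (z * p))) := by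
    have e1 : p * x * p * (p * (z * p)) = p * (x * (p * (z * p))) := by
      calc p * x * p * (p * (z * p)) = p * x * (p * p) * z * p := by noncomm_ring
        _ = p * (x * (p * (z * p))) := by rw [hp]; noncomm_ring
    have e2 : x * (p * (z * p)) * p = x * (p * (z * p)) := by
      calc x * (p * (z * p)) * p = x * p * z * (p * p) := by noncomm_ring
        _ = x * (p * (z * p)) := by rw [hp]; noncomm_ring
    rw [e1, htr p, e2]
  simp [compressL1, h1]
  left
  exact h

/-- `c = E_N(a)`, for the `τ`-preserving conditional expectation `E_N` onto `N`: `c` is the element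
of `N` with `τ(c n) = τ(a n)` for all `n ∈ N`. -/
def IsCondExp (τ : StrongDual ℂ R) (N : Set R) (a c : R) : Prop :=
  c ∈ N ∧ ∀ n ∈ N, τ (c * n) = τ (a * n)

/-- `η = E_N(ξ)`, for the `τ_e`-preserving conditional expectation `E_N : L¹(eRe) → L¹(N)`,
`N ⊆ eRe`: `η` is the element of `L¹(N)` with `τ_e(η n) = τ_e(ξ n)` for all `n ∈ N`. -/
def IsCondExpL1 (τ : StrongDual ℂ R) (e : R) (N : Set R) (ξ η : StrongDual ℂ (corner e)) : Prop :=
  η ∈ L1 τ e N ∧ ∀ n ∈ N, ∃ hn : n ∈ corner e, η ⟨n, hn⟩ = ξ ⟨n, hn⟩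

/-- The algebras `A₁, A₂ ⊇ B` are free with amalgamation over `B`: `E_B(a₁ a₂ ⋯ aₙ) = 0` for
`n ≥ 1` whenever `E_B(aₖ) = 0` for all `k` and the `aₖ` lie alternately in `A₁` and `A₂`. -/
def FreeOver (τ : StrongDual ℂ R) (B : Set R) (A₁ A₂ : Subalgebra ℂ R) : Prop :=
  ∀ l : List (Bool × R), l ≠ [] → l.IsChain (fun x y => x.1 ≠ y.1) →
    (∀ x ∈ l, x.2 ∈ (if x.1 then A₁ else A₂) ∧ IsCondExp τ B x.2 0) →
    IsCondExp τ B (l.map Prod.snd).prod 0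

/-- `x` and `y` are `B`-free: so are the algebras generated by `B`, `x` and by `B`, `y`. -/
def FreeElementsOver (τ : StrongDual ℂ R) (B : Set R) (x y : R) : Prop :=
  FreeOver τ B (Algebra.adjoin ℂ (B ∪ {x})) (Algebra.adjoin ℂ (B ∪ {y}))

/-- `x` is independent from the algebra `B`: the algebra generated by `x` commutes with `B`, and
`τ` is multiplicative on products of elements of the two. -/
def IndependentFrom (τ : StrongDual ℂ R) (x : R) (B : Set R) : Prop :=
  ∀ a ∈ Algebra.adjoin ℂ {x}, ∀ b ∈ B, Commute a b ∧ τ (a * b) = τ a * τ b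

end Analytic

/-! ### Von Neumann algebras and conjugate variables -/

section VonNeumann

variable {H : Type*} [NormedAddCommGroup H] [InnerProductSpace ℂ H] [CompleteSpace H]

/-- `τ` is a faithful normal trace state on `M`; normality is continuity in the `σ`-weak topology,
i.e. `τ(x) = ∑ᵢ ⟪ξᵢ, x ηᵢ⟫` with `∑ᵢ ‖ξᵢ‖² < ∞` and `∑ᵢ ‖ηᵢ‖² < ∞`. -/
structure IsFaithfulNormalTraceState (M : VonNeumannAlgebra H)
    (τ : StrongDual ℂ M.toStarSubalgebra) : Prop where
  map_one : τ 1 = 1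
  nonneg : ∀ x, 0 ≤ (τ (star x * x)).re ∧ (τ (star x * x)).im = 0
  faithful : ∀ x, τ (star x * x) = 0 → x = 0
  trace : ∀ x y, τ (x * y) = τ (y * x)
  normal : ∃ ξ η : ℕ → H, Summable (fun i => ‖ξ i‖ ^ 2) ∧ Summable (fun i => ‖η i‖ ^ 2) ∧
    ∀ x : M.toStarSubalgebra, HasSum (fun i => inner ℂ (ξ i) ((x : H →L[ℂ] H) (η i))) (τ x)

/-- The closure of `A ⊆ M` in the weak operator topology.  For a `*`-subalgebra `A` of `M`, or of a
corner `eMe` with `e ∈ A`, this is the von Neumann algebra `W*(A)` generated by `A`. -/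
def wStar (M : VonNeumannAlgebra H) (A : Set M.toStarSubalgebra) : Set M.toStarSubalgebra :=
  {x | ContinuousLinearMapWOT.ofCLM (x : H →L[ℂ] H) ∈
    closure ((fun a : M.toStarSubalgebra =>
      ContinuousLinearMapWOT.ofCLM (a : H →L[ℂ] H)) '' A)}

/-- In the `W*`-probability space `(eMe, τ_e)`, with `e ∈ B ⊆ eMe` and `X ∈ eMe`:
`X` is algebraically free from `B`, and `J` is a conjugate variable `J(X:B)`, i.e.
`J ∈ L¹(W*(B⟨X⟩))` and `τ_e(J m) = (τ_e ⊗ τ_e)(∂_{X:B} m)` for `m ∈ B⟨X⟩`.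
For `e = 1` this is the notion for `(M, τ)`. -/
structure IsConjugateVariable (M : VonNeumannAlgebra H) (τ : StrongDual ℂ M.toStarSubalgebra)
    (e : M.toStarSubalgebra) (B : Submodule ℂ M.toStarSubalgebra) (X : M.toStarSubalgebra)
    (J : StrongDual ℂ (corner e)) : Prop where
  algebraicallyFree : AlgebraicallyFree B X
  mem_L1 : J ∈ L1 τ e (wStar M (polyAlg B X : Set M.toStarSubalgebra))
  eq_diffQuot : ∃ D, IsFreeDifferenceQuotient e B X D ∧
    ∀ m : polyAlg B X, ∃ hm : (m : M.toStarSubalgebra) ∈ corner e,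
      J ⟨m, hm⟩ = tensorSquare (cornerTrace τ e : M.toStarSubalgebra →ₗ[ℂ] ℂ) (polyAlg B X) (D m)

end VonNeumann

end

end FreeProb

/-! Write `J` for the conjugate variable of `X` over `B`, `α = τ(p)` and `q = p - α`. The heart of
the matter is that `B`-freeness extends the relation `τ(J m) = (τ ⊗ τ)(∂ m)` from `B⟨X⟩` to
`B[p]⟨X⟩`, with the same `J` (`apply_eq_tensorFunctional`). By independence `E_B(q) = 0`. Since `q`
commutes with `B` and `q²` is a combination of `q` and `1`, the algebra `B[p]⟨X⟩` is spanned by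
`B⟨X⟩` and the reduced words `u q w₁ q ⋯ q v`, whose letters lie in `B⟨X⟩` and whose interior
letters are centred over `B` (`polyAlg_le_reducedSpan`). Both sides of the relation vanish on a
reduced word. Freeness and the trace property give `τ = 0` on reduced words
(`ReducedWord.apply_eq_zero`). Left multiplication by `B⟨X⟩` preserves them, so `L¹`-approximation
of `J` from `B⟨X⟩` gives `τ(J m) = 0`. Finally, `∂` kills `q` and cuts a single letter, so each
resulting tensor has a reduced word in one leg.

The compression is then bookkeeping of scalars. With `X_p = α⁻¹ p X p` one has `∂_X X_p = α⁻¹ p ⊗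
p`, hence `∂_X = α⁻¹ ∂_{X_p}` on `Bp⟨X_p⟩`, and `τ_p(pJp m) = α⁻¹ τ(J m) = α⁻² (τ ⊗ τ)(∂_{X_p} m) =
(τ_p ⊗ τ_p)(∂_{X_p} m)`. Conditioning onto `W*(Bp⟨X_p⟩)` does not change these pairings.

The analytic input concerns `L¹`, realized inside a Banach dual. An approximate polar decomposition
shows that the `L¹`-norm of an element of a `*`-algebra `P` can be tested on `P` alone
(`norm_apply_mul_le`). This yields existence of conditional expectations on `L¹`, uniqueness of an
element of `L¹(P)` with given values on `P`, and orthogonality in the construction of `E_B` on `M`.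
The σ-strong density of `P` in `W*(P)` shows that `L¹(W*(P))` is contained in `L¹(P)`
(`L1_wStar_subset`). -/

namespace FreeProb

noncomputable section

set_option linter.unusedSectionVars false

/-! ### Existence of the free difference quotient -/

section DiffQuot

variable {R : Type*} [Ring R] [Algebra ℂ R]

/-- The linear map `b₀ ⊗ b₁ ⊗ ⋯ ⊗ bₙ ↦ f(b₀) x f(b₁) x ⋯ x f(bₙ)`. -/
def wordMap {A : Type*} [Semiring A] [Algebra ℂ A] {B : Submodule ℂ R} (f : B →ₗ[ℂ] A) (x : A)
    (n : ℕ) : (⨂[ℂ] _ : Fin (n + 1), B) →ₗ[ℂ] A :=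
  PiTensorProduct.lift
    ((MultilinearMap.mkPiAlgebraFin ℂ (n + 1) A).compLinearMap fun i =>
      if i = 0 then f else LinearMap.mulLeft ℂ x ∘ₗ f)

theorem wordMap_tprod {A : Type*} [Semiring A] [Algebra ℂ A] {B : Submodule ℂ R} (f : B →ₗ[ℂ] A)
    (x : A) (n : ℕ) (b : Fin (n + 1) → B) :
    wordMap f x n (PiTensorProduct.tprod ℂ b) =
      f (b 0) * (List.ofFn fun i : Fin n => x * f (b i.succ)).prod := by
  simp [wordMap, List.ofFn_succ]

theorem monomialMap_eq_wordMap (B : Submodule ℂ R) (X : R) (n : ℕ) :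
    monomialMap B X n = wordMap B.subtype X n := rfl

/-- The coefficient `c` is absorbed into the zeroth tensor leg. -/
theorem exists_wordMap_coeff_mul {A : Type*} [Semiring A] [Algebra ℂ A] {B : Submodule ℂ R}
    (hmul : ∀ a ∈ B, ∀ b ∈ B, a * b ∈ B) (f : B →ₗ[ℂ] A)
    (hf : ∀ a b : B, f ⟨a * b, hmul a a.2 b b.2⟩ = f a * f b) (x : A) (c : B)
    (u : DirectSum ℕ fun n => ⨂[ℂ] _ : Fin (n + 1), B) :
    ∃ u', DirectSum.toModule ℂ ℕ A (wordMap f x) u' =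
      f c * DirectSum.toModule ℂ ℕ A (wordMap f x) u := by
  induction u using DirectSum.induction_on with
  | zero => exact ⟨0, by simp⟩
  | add u v hu hv =>
    obtain ⟨u', hu⟩ := hu
    obtain ⟨v', hv⟩ := hv
    exact ⟨u' + v', by rw [map_add, map_add, hu, hv, mul_add]⟩
  | of n t =>
    induction t using PiTensorProduct.induction_on with
    | smul_tprod r b =>
      refine ⟨DirectSum.lof ℂ ℕ _ n (r • PiTensorProduct.tprod ℂ
        (Fin.cons ⟨c * b 0, hmul c c.2 _ (b 0).2⟩ fun i : Fin n => b i.succ)), ?_⟩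
      rw [← DirectSum.lof_eq_of ℂ, DirectSum.toModule_lof, DirectSum.toModule_lof, map_smul,
        map_smul, wordMap_tprod, wordMap_tprod]
      simp [hf, mul_assoc]
    | add s t hs ht =>
      obtain ⟨u', hu⟩ := hs
      obtain ⟨v', hv⟩ := ht
      exact ⟨u' + v', by rw [map_add, map_add, hu, hv, map_add, mul_add]⟩

/-- The degree goes up by one, with `e` as the new zeroth leg; `hx` makes that leg invisible. -/
theorem exists_wordMap_var_mul {A : Type*} [Semiring A] [Algebra ℂ A] {B : Submodule ℂ R}
    (f : B →ₗ[ℂ] A) (x : A) (e : B) (hx : f e * x = x)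
    (u : DirectSum ℕ fun n => ⨂[ℂ] _ : Fin (n + 1), B) :
    ∃ u', DirectSum.toModule ℂ ℕ A (wordMap f x) u' =
      x * DirectSum.toModule ℂ ℕ A (wordMap f x) u := by
  induction u using DirectSum.induction_on with
  | zero => exact ⟨0, by simp⟩
  | add u v hu hv =>
    obtain ⟨u', hu⟩ := hu
    obtain ⟨v', hv⟩ := hv
    exact ⟨u' + v', by rw [map_add, map_add, hu, hv, mul_add]⟩
  | of n t =>
    induction t using PiTensorProduct.induction_on with
    | smul_tprod r b =>
      refine ⟨DirectSum.lof ℂ ℕ _ (n + 1) (r • PiTensorProduct.tprod ℂ (Fin.cons e b)), ?_⟩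
      rw [← DirectSum.lof_eq_of ℂ, DirectSum.toModule_lof, DirectSum.toModule_lof, map_smul,
        map_smul, wordMap_tprod, wordMap_tprod]
      simp only [Fin.cons_zero, Fin.cons_succ, List.ofFn_succ, List.prod_cons]
      rw [← mul_assoc, ← mul_assoc, hx, mul_smul_comm, mul_assoc]
    | add s t hs ht =>
      obtain ⟨u', hu⟩ := hs
      obtain ⟨v', hv⟩ := ht
      exact ⟨u' + v', by rw [map_add, map_add, hu, hv, map_add, mul_add]⟩

/-! ### Operators encoding the pair `(m, ∂m)` -/

section Operators

variable (B : Submodule ℂ R) (X : R)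

/-- Left multiplication on `B⟨X⟩ ⊕ B⟨X⟩ ⊗ B⟨X⟩`. -/
def leftMulOp : polyAlg B X →ₗ[ℂ]
    Module.End ℂ (polyAlg B X × (polyAlg B X ⊗[ℂ] polyAlg B X)) where
  toFun a := (LinearMap.mulLeft ℂ a).prodMap ((LinearMap.mulLeft ℂ a).rTensor (polyAlg B X))
  map_add' a b := by
    have : LinearMap.mulLeft ℂ (a + b) = LinearMap.mulLeft ℂ a + LinearMap.mulLeft ℂ b := by
      ext; simp [add_mul]
    rw [this, LinearMap.rTensor_add]
    rfl
  map_smul' r a := by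
    have : LinearMap.mulLeft ℂ (r • a) = r • LinearMap.mulLeft ℂ a := by
      ext; simp
    rw [this, LinearMap.rTensor_smul]
    rfl

theorem leftMulOp_apply (a y : polyAlg B X) (t : polyAlg B X ⊗[ℂ] polyAlg B X) :
    leftMulOp B X a (y, t) = (a * y, (LinearMap.mulLeft ℂ a).rTensor (polyAlg B X) t) := rfl

theorem leftMulOp_mul (a b : polyAlg B X) :
    leftMulOp B X (a * b) = leftMulOp B X a * leftMulOp B X b := by
  refine LinearMap.ext fun z => ?_
  obtain ⟨y, t⟩ := z
  rw [Module.End.mul_apply, leftMulOp_apply, leftMulOp_apply, leftMulOp_apply, mul_assoc,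
    LinearMap.mulLeft_mul, LinearMap.rTensor_comp]
  rfl

/-- The operator `(y, t) ↦ (X y, e ⊗ y + X t)` on `B⟨X⟩ ⊕ B⟨X⟩ ⊗ B⟨X⟩`. -/
def varOp (e : polyAlg B X) :
    Module.End ℂ (polyAlg B X × (polyAlg B X ⊗[ℂ] polyAlg B X)) :=
  leftMulOp B X ⟨X, var_mem_polyAlg B X⟩ +
    LinearMap.inr ℂ _ _ ∘ₗ TensorProduct.mk ℂ _ _ e ∘ₗ LinearMap.fst ℂ _ _

theorem varOp_apply (e y : polyAlg B X) (t : polyAlg B X ⊗[ℂ] polyAlg B X) :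
    varOp B X e (y, t) = (⟨X, var_mem_polyAlg B X⟩ * y, e ⊗ₜ[ℂ] y +
      (LinearMap.mulLeft ℂ ⟨X, var_mem_polyAlg B X⟩).rTensor (polyAlg B X) t) := by
  simp [varOp, leftMulOp_apply, add_comm]

end Operators

theorem polyAlg_unit_mul {B : Submodule ℂ R} {X e : R} (hl : ∀ b ∈ B, e * b = b)
    (hX : e * X = X) {a : R} (ha : a ∈ polyAlg B X) : e * a = a := by
  induction ha using NonUnitalAlgebra.adjoin_induction with
  | mem y hy => rcases hy with hy | rfl; exacts [hl y hy, hX]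
  | add y z _ _ h1 h2 => rw [mul_add, h1, h2]
  | zero => simp
  | mul y z _ _ h1 h2 => rw [← mul_assoc, h1]
  | smul c y _ h1 => rw [mul_smul_comm, h1]

theorem polyAlg_mul_unit {B : Submodule ℂ R} {X e : R} (hr : ∀ b ∈ B, b * e = b)
    (hX : X * e = X) {a : R} (ha : a ∈ polyAlg B X) : a * e = a := by
  induction ha using NonUnitalAlgebra.adjoin_induction with
  | mem y hy => rcases hy with hy | rfl; exacts [hr y hy, hX]
  | add y z _ _ h1 h2 => rw [add_mul, h1, h2]
  | zero => simp
  | mul y z _ _ h1 h2 => rw [mul_assoc, h2]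
  | smul c y _ h1 => rw [smul_mul_assoc, h1]

/-- To prove `Q y` for `y ∈ B⟨X⟩` it suffices to prove it for the unit of `B` and show stability
under linear combinations and left multiplication by the generators. -/
theorem polyAlg_left_induction {B : Submodule ℂ R} {X e : R}
    (hr : ∀ b ∈ B, b * e = b) (hX : X * e = X) {S : Submodule ℂ R} (hS : e ∈ S)
    (hB : ∀ b ∈ B, ∀ y ∈ S, b * y ∈ S) (hXS : ∀ y ∈ S, X * y ∈ S) {a : R}
    (ha : a ∈ polyAlg B X) : a ∈ S := by
  have key : ∀ y ∈ S, a * y ∈ S := by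
    induction ha using NonUnitalAlgebra.adjoin_induction with
    | mem y hy => rcases hy with hy | rfl; exacts [hB y hy, hXS]
    | add y z _ _ h1 h2 => intro w hw; rw [add_mul]; exact S.add_mem (h1 w hw) (h2 w hw)
    | zero => simp
    | mul y z _ _ h1 h2 => intro w hw; rw [mul_assoc]; exact h1 _ (h2 _ hw)
    | smul c y _ h1 => intro w hw; rw [smul_mul_assoc]; exact S.smul_mem _ (h1 w hw)
  have := key e hS
  rwa [polyAlg_mul_unit hr hX ha] at this

/-- Letting polynomials act on `P ⊕ P ⊗ P`, with coefficients acting by left multiplication and the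
variable by `varOp`, sends `(e, 0)` to `(m, ∂m)`. Algebraic freeness identifies abstract polynomials
with `P`, so the second component is a well defined map on `P`. It satisfies the Leibniz rule for
left multiplication by generators, and induction on the left factor gives the general rule. -/
theorem exists_isFreeDifferenceQuotient {e : R} {B : Submodule ℂ R} {X : R} (he : e ∈ B)
    (hmul : ∀ a ∈ B, ∀ b ∈ B, a * b ∈ B) (hl : ∀ b ∈ B, e * b = b) (hr : ∀ b ∈ B, b * e = b)
    (hlX : e * X = X) (hrX : X * e = X) (hfree : AlgebraicallyFree B X) :
    ∃ D, IsFreeDifferenceQuotient e B X D := by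
  let P := polyAlg B X
  let e' : P := ⟨e, coeff_mem_polyAlg he⟩
  let X' : P := ⟨X, var_mem_polyAlg B X⟩
  have e'_mul : ∀ a : P, e' * a = a := fun a => Subtype.ext (polyAlg_unit_mul hl hlX a.2)
  have mul_e' : ∀ a : P, a * e' = a := fun a => Subtype.ext (polyAlg_mul_unit hr hrX a.2)
  let ι : B →ₗ[ℂ] P := Submodule.inclusion (p' := P.toSubmodule) fun b hb => coeff_mem_polyAlg hb
  let f : B →ₗ[ℂ] Module.End ℂ (P × (P ⊗[ℂ] P)) := leftMulOp B X ∘ₗ ι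
  let x := varOp B X e'
  have f_apply : ∀ (b : B) (y : P) (t : P ⊗[ℂ] P), f b (y, t) =
      (ι b * y, (LinearMap.mulLeft ℂ (ι b)).rTensor P t) := fun b y t => rfl
  have x_apply : ∀ z, x z = (X' * z.1, e' ⊗ₜ[ℂ] z.1 +
      (LinearMap.mulLeft ℂ X').rTensor P z.2) := fun z => varOp_apply B X e' z.1 z.2
  have hf : ∀ a b : B, f ⟨a * b, hmul a a.2 b b.2⟩ = f a * f b := fun a b =>
    leftMulOp_mul B X (ι a) (ι b)
  have rT_e : (LinearMap.mulLeft ℂ e').rTensor P = LinearMap.id := by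
    have : LinearMap.mulLeft ℂ e' = LinearMap.id := LinearMap.ext e'_mul
    rw [this, LinearMap.rTensor_id]
  have hx : f ⟨e, he⟩ * x = x := by
    refine LinearMap.ext fun z => ?_
    obtain ⟨y, t⟩ := z
    have h1 : ι ⟨e, he⟩ = e' := rfl
    rw [Module.End.mul_apply, varOp_apply, f_apply, h1, e'_mul, rT_e]
    rfl
  let Φ := DirectSum.toModule ℂ ℕ _ (wordMap f x)
  let Ψ := DirectSum.toModule ℂ ℕ R (monomialMap B X)
  have fst_prod : ∀ (l : List B) (z : P × (P ⊗[ℂ] P)),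
      (((l.map fun b => x * f b).prod z).1 : R) = (l.map fun b : B => X * (b : R)).prod * z.1 := by
    intro l
    induction l with
    | nil => intro z; simp
    | cons b l ih =>
      intro z
      rw [List.map_cons, List.prod_cons, List.map_cons, List.prod_cons, mul_assoc, mul_assoc,
        mul_assoc, ← ih, Module.End.mul_apply, Module.End.mul_apply, x_apply]
      rfl
  have hΦΨ : ∀ u, ((Φ u (e', 0)).1 : R) = Ψ u := by
    intro u
    induction u using DirectSum.induction_on with
    | zero => simp
    | add u v hu hv => rw [map_add, map_add, LinearMap.add_apply, ← hu, ← hv]; rfl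
    | of n t =>
      induction t using PiTensorProduct.induction_on with
      | smul_tprod r b =>
        simp only [Φ, Ψ]
        rw [← DirectSum.lof_eq_of ℂ, DirectSum.toModule_lof, DirectSum.toModule_lof, map_smul,
          map_smul, monomialMap_eq_wordMap, wordMap_tprod, wordMap_tprod]
        have h1 := fst_prod (List.ofFn fun i => b i.succ) (e', 0)
        rw [List.map_ofFn, List.map_ofFn] at h1
        simp only [Function.comp_def] at h1
        have h2 : ((f (b 0) ((List.ofFn fun i : Fin n => x * f (b i.succ)).prod (e', 0))).1 : R) =
          (b 0 : R) * ((List.ofFn fun i : Fin n => x * f (b i.succ)).prod (e', 0)).1 := rfl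
        -- The trailing unit, coming from the start vector `(e, 0)`, is absorbed by the last
        -- coefficient, which is `b 0` exactly when the degree is zero.
        have h3 : (b 0 : R) * ((List.ofFn fun i : Fin n => X * (b i.succ : R)).prod * e) =
            (b 0 : R) * (List.ofFn fun i : Fin n => X * (b i.succ : R)).prod := by
          rcases n with _ | n
          · simp [hr _ (b 0).2]
          · congr 1
            rw [← List.prod_concat, List.concat_eq_append]
            have : (List.ofFn fun i : Fin (n + 1) => X * (b i.succ : R)) =
              (List.ofFn fun i : Fin n => X * (b i.castSucc.succ : R)) ++
                [X * (b (Fin.last n).succ : R)] := by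
              rw [List.ofFn_succ']; simp
            rw [this]
            simp only [List.prod_append, List.prod_singleton]
            rw [mul_assoc, mul_assoc, hr _ (b (Fin.last n).succ).2]
        rw [LinearMap.smul_apply, Module.End.mul_apply, Prod.smul_fst]
        change r • ((f (b 0) ((List.ofFn fun i : Fin n => x * f (b i.succ)).prod (e', 0))).1 : R)
          = _
        rw [h2, h1]
        exact congrArg _ h3
      | add s t hs ht => rw [map_add, map_add, map_add, LinearMap.add_apply, ← hs, ← ht]; rfl
  have hcoeff : ∀ (b : B) u, ∃ u', Φ u' = f b * Φ u := fun b u =>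
    exists_wordMap_coeff_mul hmul f hf x b u
  have hvar : ∀ u, ∃ u', Φ u' = x * Φ u := fun u => exists_wordMap_var_mul f x ⟨e, he⟩ hx u
  let ε := DirectSum.lof ℂ ℕ (fun n => ⨂[ℂ] _ : Fin (n + 1), B) 0
    (PiTensorProduct.tprod ℂ fun _ => ⟨e, he⟩)
  have hε : Φ ε (e', 0) = (e', 0) := by
    simp only [Φ, ε]
    rw [DirectSum.toModule_lof, wordMap_tprod]
    simp only [List.ofFn_zero, List.prod_nil, mul_one]
    rw [f_apply, map_zero]
    exact congrArg₂ Prod.mk (e'_mul e') rfl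
  have hsurj : ∀ y : P, ∃ u, Ψ u = y := by
    intro y
    refine polyAlg_left_induction hr hrX (S := LinearMap.range Ψ) ⟨ε, ?_⟩ ?_ ?_ y.2
    · rw [← hΦΨ, hε]
    · rintro b hb _ ⟨u, rfl⟩
      obtain ⟨u', hu'⟩ := hcoeff ⟨b, hb⟩ u
      refine ⟨u', ?_⟩
      rw [← hΦΨ, ← hΦΨ, hu']
      rfl
    · rintro _ ⟨u, rfl⟩
      obtain ⟨u', hu'⟩ := hvar u
      refine ⟨u', ?_⟩
      rw [← hΦΨ, ← hΦΨ, hu', Module.End.mul_apply, x_apply]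
      rfl
  have hmem : ∀ u, Ψ u ∈ P := fun u => by rw [← hΦΨ]; exact ((Φ u (e', 0)).1).2
  let Ψ' : (DirectSum ℕ fun n => ⨂[ℂ] _ : Fin (n + 1), B) ≃ₗ[ℂ] P :=
    LinearEquiv.ofBijective (Ψ.codRestrict P.toSubmodule hmem)
      ⟨fun u v h => hfree (congrArg Subtype.val h), fun y => (hsurj y).imp fun u hu =>
        Subtype.ext hu⟩
  have hΨ' : ∀ u, Ψ' u = (Φ u (e', 0)).1 := fun u => Subtype.ext (hΦΨ u).symm
  let D : P →ₗ[ℂ] P ⊗[ℂ] P :=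
    LinearMap.snd ℂ _ _ ∘ₗ LinearMap.applyₗ (e', 0) ∘ₗ Φ ∘ₗ Ψ'.symm.toLinearMap
  have hD : ∀ u, (Ψ' u, D (Ψ' u)) = Φ u (e', 0) := by
    intro u
    refine Prod.ext (hΨ' u) ?_
    simp [D]
  have D_coeff : ∀ (b : B) (y : P), D (ι b * y) = (LinearMap.mulLeft ℂ (ι b)).rTensor P (D y) := by
    intro b y
    obtain ⟨u, rfl⟩ := Ψ'.surjective y
    obtain ⟨u', hu'⟩ := hcoeff b u
    have h := hD u'
    rw [hu', Module.End.mul_apply, ← hD, f_apply] at h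
    obtain ⟨h1, h2⟩ := Prod.mk.inj h
    rw [h1] at h2
    exact h2
  have D_var : ∀ y : P, D (X' * y) = e' ⊗ₜ[ℂ] y + (LinearMap.mulLeft ℂ X').rTensor P (D y) := by
    intro y
    obtain ⟨u, rfl⟩ := Ψ'.surjective y
    obtain ⟨u', hu'⟩ := hvar u
    have h := hD u'
    rw [hu', Module.End.mul_apply, ← hD, varOp_apply] at h
    obtain ⟨h1, h2⟩ := Prod.mk.inj h
    rw [h1] at h2
    exact h2
  have D_e : D e' = 0 := by
    have h := hD ε
    rw [hε] at h
    obtain ⟨h1, h2⟩ := Prod.mk.inj h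
    rw [h1] at h2
    exact h2
  have D_B : ∀ b : B, D (ι b) = 0 := by
    intro b
    rw [← mul_e' (ι b), D_coeff, D_e, map_zero]
  have D_X : D X' = e' ⊗ₜ[ℂ] e' := by
    rw [← mul_e' X', D_var, D_e, map_zero, add_zero]
  refine ⟨D, ?_, fun b hb => D_B ⟨b, hb⟩, he, D_X⟩
  have key : ∀ a (ha : a ∈ P), ∀ b : P, D (⟨a, ha⟩ * b) =
      (LinearMap.mulRight ℂ b).lTensor P (D ⟨a, ha⟩) +
        (LinearMap.mulLeft ℂ ⟨a, ha⟩).rTensor P (D b) := by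
    intro a ha
    induction ha using NonUnitalAlgebra.adjoin_induction with
    | mem y hy =>
      intro b
      rcases hy with hy | hy
      · have h1 := D_coeff ⟨y, hy⟩ b
        have h2 := D_B ⟨y, hy⟩
        change D (ι ⟨y, hy⟩ * b) = (LinearMap.mulRight ℂ b).lTensor P (D (ι ⟨y, hy⟩)) + _
        rw [h1, h2, map_zero, zero_add]
        rfl
      · obtain rfl : y = X := hy
        change D (X' * b) = (LinearMap.mulRight ℂ b).lTensor P (D X') + _
        rw [D_var, D_X, LinearMap.lTensor_tmul, LinearMap.mulRight_apply, e'_mul]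
    | add y z hy hz h1 h2 =>
      intro b
      have e1 : (⟨y + z, add_mem hy hz⟩ : P) = ⟨y, hy⟩ + ⟨z, hz⟩ := rfl
      have e2 : ∀ a b : P, LinearMap.mulLeft ℂ (a + b) =
        LinearMap.mulLeft ℂ a + LinearMap.mulLeft ℂ b := fun a b => by ext; simp [add_mul]
      rw [e1, add_mul, map_add, map_add, map_add, h1 b, h2 b, e2, LinearMap.rTensor_add,
        LinearMap.add_apply]
      abel
    | zero =>
      intro b
      have e1 : (⟨0, zero_mem P⟩ : P) = 0 := rfl
      have e2 : LinearMap.mulLeft ℂ (0 : P) = 0 := by ext; simp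
      rw [e1, zero_mul, map_zero, map_zero, e2, LinearMap.rTensor_zero]
      simp
    | mul y z hy hz h1 h2 =>
      intro b
      have e1 : (⟨y * z, mul_mem hy hz⟩ : P) = ⟨y, hy⟩ * ⟨z, hz⟩ := rfl
      rw [e1, mul_assoc, h1, h2, h1 ⟨z, hz⟩, map_add, map_add, LinearMap.mulRight_mul,
        LinearMap.lTensor_comp, LinearMap.mulLeft_mul, LinearMap.rTensor_comp, ← add_assoc]
      have e3 : ∀ (f g : P →ₗ[ℂ] P) (w : P ⊗[ℂ] P),
          f.rTensor P (g.lTensor P w) = g.lTensor P (f.rTensor P w) := fun f g w =>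
        LinearMap.congr_fun (((LinearMap.rTensor_comp_lTensor ..).trans
          (LinearMap.lTensor_comp_rTensor ..).symm :
            f.rTensor P ∘ₗ g.lTensor P = g.lTensor P ∘ₗ f.rTensor P)) w
      exact congrArg₂ (· + ·) (congrArg₂ (· + ·) rfl (e3 _ _ _)) rfl
    | smul c y hy h1 =>
      intro b
      have e1 : (⟨c • y, SMulMemClass.smul_mem c hy⟩ : P) = c • ⟨y, hy⟩ := rfl
      have e2 : ∀ a : P, LinearMap.mulLeft ℂ (c • a) = c • LinearMap.mulLeft ℂ a :=
        fun a => by ext; simp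
      rw [e1, smul_mul_assoc, map_smul, map_smul, map_smul, h1, e2, LinearMap.rTensor_smul,
        LinearMap.smul_apply, smul_add]
  exact fun a b => key a.1 a.2 b

end DiffQuot

/-! ### Algebraic freeness of compressions, and comparison of difference quotients -/

section Compression

variable {R : Type*} [Ring R] [Algebra ℂ R]

/-- Over a field the inclusion has a linear left inverse, whose tensor power is again a left
inverse. -/
theorem piTensorProduct_map_inclusion_injective {B C : Submodule ℂ R} (h : B ≤ C) (n : ℕ) :
    Function.Injective
      (PiTensorProduct.map fun _ : Fin n => Submodule.inclusion h) := by
  obtain ⟨g, hg⟩ := LinearMap.exists_leftInverse_of_injective (Submodule.inclusion h)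
    (LinearMap.ker_eq_bot.2 (Submodule.inclusion_injective h))
  have : PiTensorProduct.map (fun _ : Fin n => g) ∘ₗ
      PiTensorProduct.map (fun _ : Fin n => Submodule.inclusion h) = LinearMap.id := by
    rw [← PiTensorProduct.map_comp]
    simp only [hg]
    exact PiTensorProduct.map_id
  exact Function.LeftInverse.injective (LinearMap.congr_fun this)

/-- Each `p` next to an `X` is swallowed by the neighbouring coefficient, leaving one scalar `c` per
occurrence of the variable. The prefix `a` with `a * p = a` makes the induction run. -/
theorem mul_prod_compression {p X : R} {c : ℂ} (l : List R) (hl : ∀ b ∈ l, p * b = b)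
    (hr : ∀ b ∈ l, b * p = b) {a : R} (ha : a * p = a) :
    a * (l.map fun b => (c • (p * X * p)) * b).prod =
      c ^ l.length • (a * (l.map fun b => X * b).prod) := by
  induction l generalizing a with
  | nil => simp
  | cons b l ih =>
    simp only [List.forall_mem_cons] at hl hr
    have h1 : a * ((c • (p * X * p)) * b) = c • (a * (X * b)) := by
      calc a * ((c • (p * X * p)) * b) = c • ((a * p) * (X * (p * b))) := by
            simp only [smul_mul_assoc, mul_smul_comm, mul_assoc]
        _ = c • (a * (X * b)) := by rw [ha, hl.1]
    have h2 : a * (X * b) * p = a * (X * b) := by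
      rw [mul_assoc, mul_assoc, hr.1]
    rw [List.map_cons, List.prod_cons, List.map_cons, List.prod_cons, ← mul_assoc, h1,
      smul_mul_assoc, ih hl.2 hr.2 h2, smul_smul, List.length_cons, pow_succ', mul_assoc a]

theorem monomialMap_compression {B C : Submodule ℂ R} (h : B ≤ C) {p X : R} {c : ℂ}
    (hl : ∀ b ∈ B, p * b = b) (hr : ∀ b ∈ B, b * p = b) (n : ℕ) :
    monomialMap B (c • (p * X * p)) n =
      monomialMap C X n ∘ₗ (c ^ n • PiTensorProduct.map fun _ => Submodule.inclusion h) := by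
  ext b
  simp only [LinearMap.compMultilinearMap_apply, LinearMap.comp_apply, LinearMap.smul_apply,
    map_smul, PiTensorProduct.map_tprod, monomialMap_eq_wordMap, wordMap_tprod]
  have := mul_prod_compression (p := p) (X := X) (c := c) (List.ofFn fun i : Fin n => (b i.succ : R))
    (by simpa [List.mem_ofFn] using fun i => hl _ (b _).2)
    (by simpa [List.mem_ofFn] using fun i => hr _ (b _).2) (hr _ (b 0).2)
  rw [List.map_ofFn, List.map_ofFn, List.length_ofFn] at this
  exact this

/-- Evaluation at `c p X p` is evaluation at `X` after the graded inclusion rescaled by `c ^ n` in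
degree `n`, which stays injective as `c ≠ 0`. -/
theorem AlgebraicallyFree.compression {B C : Submodule ℂ R} (h : B ≤ C) {p X : R} {c : ℂ}
    (hc : c ≠ 0) (hl : ∀ b ∈ B, p * b = b) (hr : ∀ b ∈ B, b * p = b)
    (hfree : AlgebraicallyFree C X) : AlgebraicallyFree B (c • (p * X * p)) := by
  let g : ∀ n : ℕ, (⨂[ℂ] _ : Fin (n + 1), B) →ₗ[ℂ] ⨂[ℂ] _ : Fin (n + 1), C :=
    fun n => c ^ n • PiTensorProduct.map fun _ => Submodule.inclusion h
  have hg : ∀ n, Function.Injective (g n) := fun n x y hxy =>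
    piTensorProduct_map_inclusion_injective h (n + 1)
      (smul_right_injective _ (pow_ne_zero n hc) hxy)
  have key : DirectSum.toModule ℂ ℕ R (monomialMap B (c • (p * X * p))) =
      DirectSum.toModule ℂ ℕ R (monomialMap C X) ∘ₗ DirectSum.lmap g := by
    refine DirectSum.linearMap_ext _ fun n => ?_
    refine LinearMap.ext fun t => ?_
    rw [LinearMap.comp_apply, LinearMap.comp_apply, LinearMap.comp_apply, DirectSum.lmap_lof,
      DirectSum.toModule_lof, DirectSum.toModule_lof, monomialMap_compression h hl hr n]
    rfl
  rw [AlgebraicallyFree, key]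
  exact hfree.comp (DirectSum.lmap_injective g |>.2 hg)

/-- The functional `φ ⊗ φ` on `R ⊗ R`. -/
def tensorFunctional (φ : R →ₗ[ℂ] ℂ) : R ⊗[ℂ] R →ₗ[ℂ] ℂ :=
  LinearMap.mul' ℂ ℂ ∘ₗ TensorProduct.map φ φ

@[simp] theorem tensorFunctional_tmul (φ : R →ₗ[ℂ] ℂ) (x y : R) :
    tensorFunctional φ (x ⊗ₜ y) = φ x * φ y := rfl

/-- The inclusion `P ⊗ P → R ⊗ R`. -/
def tensorIncl (P : NonUnitalSubalgebra ℂ R) : P ⊗[ℂ] P →ₗ[ℂ] R ⊗[ℂ] R :=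
  TensorProduct.map P.toSubmodule.subtype P.toSubmodule.subtype

theorem tensorIncl_tmul (P : NonUnitalSubalgebra ℂ R) (x y : P) :
    tensorIncl P (x ⊗ₜ y) = (x : R) ⊗ₜ (y : R) := rfl

/-- Difference quotients over different coefficient algebras take values in different tensor
squares; `R ⊗ R` is the common place to compare them. -/
theorem tensorSquare_eq (φ : R →ₗ[ℂ] ℂ) (P : NonUnitalSubalgebra ℂ R) (t : P ⊗[ℂ] P) :
    tensorSquare φ P t = tensorFunctional φ (tensorIncl P t) := by
  induction t with
  | zero => simp
  | add x y hx hy => rw [map_add, map_add, map_add, hx, hy]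
  | tmul x y => rfl

theorem tensorIncl_mulRight (P : NonUnitalSubalgebra ℂ R) (b : P) (t : P ⊗[ℂ] P) :
    tensorIncl P ((LinearMap.mulRight ℂ b).lTensor P t) =
      (LinearMap.mulRight ℂ (b : R)).lTensor R (tensorIncl P t) := by
  induction t with
  | zero => simp
  | add x y hx hy => simp only [map_add, hx, hy]
  | tmul x y => rfl

theorem tensorIncl_mulLeft (P : NonUnitalSubalgebra ℂ R) (b : P) (t : P ⊗[ℂ] P) :
    tensorIncl P ((LinearMap.mulLeft ℂ b).rTensor P t) =
      (LinearMap.mulLeft ℂ (b : R)).rTensor R (tensorIncl P t) := by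
  induction t with
  | zero => simp
  | add x y hx hy => simp only [map_add, hx, hy]
  | tmul x y => rfl

namespace IsFreeDifferenceQuotient

variable {e : R} {B : Submodule ℂ R} {X : R}
  {D : polyAlg B X →ₗ[ℂ] polyAlg B X ⊗[ℂ] polyAlg B X}

theorem tensorIncl_mul (h : IsFreeDifferenceQuotient e B X D) (a b : polyAlg B X) :
    tensorIncl _ (D (a * b)) = (LinearMap.mulRight ℂ (b : R)).lTensor R (tensorIncl _ (D a)) +
      (LinearMap.mulLeft ℂ (a : R)).rTensor R (tensorIncl _ (D b)) := by
  rw [h.leibniz, map_add, tensorIncl_mulRight, tensorIncl_mulLeft]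

/-- Free difference quotients for different data are proportional on the smaller algebra as soon
as this holds on the variable. -/
theorem tensorIncl_eq_smul (h : IsFreeDifferenceQuotient e B X D) {e' : R} {B' : Submodule ℂ R}
    {X' : R} {D' : polyAlg B' X' →ₗ[ℂ] polyAlg B' X' ⊗[ℂ] polyAlg B' X'}
    (h' : IsFreeDifferenceQuotient e' B' X' D') (hB : B ≤ B') (hX : X ∈ polyAlg B' X') {c : ℂ}
    (hc : tensorIncl _ (D' ⟨X, hX⟩) = c • (e ⊗ₜ[ℂ] e)) {m : R} (hm : m ∈ polyAlg B X) :
    ∃ hm' : m ∈ polyAlg B' X',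
      tensorIncl _ (D' ⟨m, hm'⟩) = c • tensorIncl _ (D ⟨m, hm⟩) := by
  have hle : polyAlg B X ≤ polyAlg B' X' := by
    refine NonUnitalAlgebra.adjoin_le ?_
    rintro y (hy | rfl)
    exacts [coeff_mem_polyAlg (hB hy), hX]
  refine ⟨hle hm, ?_⟩
  induction hm using NonUnitalAlgebra.adjoin_induction with
  | mem y hy =>
    rcases hy with hy | hy
    · rw [h'.map_coeff y (hB hy), h.map_coeff y hy]; simp
    · obtain rfl : y = X := hy
      obtain ⟨he, h1⟩ := h.map_var
      rw [hc, h1]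
      rfl
  | add y z hy hz h1 h2 =>
    have e1 := (tensorIncl _ ∘ₗ D).map_add ⟨y, hy⟩ ⟨z, hz⟩
    have e2 := (tensorIncl _ ∘ₗ D').map_add ⟨y, hle hy⟩ ⟨z, hle hz⟩
    simp only [LinearMap.comp_apply] at e1 e2
    rw [h1, h2, ← smul_add, ← e1] at e2
    exact e2
  | zero =>
    have e1 := (tensorIncl _ ∘ₗ D).map_zero
    have e2 := (tensorIncl _ ∘ₗ D').map_zero
    exact e2.trans ((smul_zero c).symm.trans (congrArg (c • ·) e1.symm))
  | mul y z hy hz h1 h2 =>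
    have e1 := h.tensorIncl_mul ⟨y, hy⟩ ⟨z, hz⟩
    have e2 := h'.tensorIncl_mul ⟨y, hle hy⟩ ⟨z, hle hz⟩
    rw [h1, h2, map_smul, map_smul, ← smul_add, ← e1] at e2
    exact e2
  | smul r y hy h1 =>
    have e1 := (tensorIncl _ ∘ₗ D).map_smul r ⟨y, hy⟩
    have e2 := (tensorIncl _ ∘ₗ D').map_smul r ⟨y, hle hy⟩
    simp only [LinearMap.comp_apply] at e1 e2
    rw [h1, smul_comm, ← e1] at e2
    exact e2

end IsFreeDifferenceQuotient

end Compression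

/-! ### Trace states on C*-algebras: the `L²` and `L¹` seminorms -/

section TraceState

variable {R : Type*} [NormedRing R] [StarRing R] [CStarRing R] [NormedAlgebra ℂ R]
  [StarModule ℂ R]

/-- `τ` is a trace state. -/
structure IsTraceState (τ : StrongDual ℂ R) : Prop where
  map_one : τ 1 = 1
  nonneg : ∀ x, 0 ≤ (τ (star x * x)).re ∧ (τ (star x * x)).im = 0
  trace : ∀ x y, τ (x * y) = τ (y * x)

/-- The square `τ(x* x)` of the `L²`-seminorm. -/
def l2Sq (τ : StrongDual ℂ R) (x : R) : ℝ := (τ (star x * x)).re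

/-- A closed one-sided multiplier argument: `z f(a)` lies in the norm closure of a `*`-subalgebra
which contains `z` and `a`. -/
theorem mul_cfc_mem_closure [CompleteSpace R] (P : NonUnitalStarSubalgebra ℂ R) {z a : R}
    (hz : z ∈ P) (ha : a ∈ P) (f : ℝ → ℝ) :
    let _ : CStarAlgebra R := {}
    z * cfc f a ∈ closure (P : Set R) := by
  intro _
  have hcl : ∀ {z w : R}, z ∈ closure (P : Set R) → w ∈ closure (P : Set R) →
      z * w ∈ closure (P : Set R) := fun hz hw =>
    map_mem_closure₂ continuous_mul hz hw fun _ h _ h' => mul_mem h h'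
  let C := P.toNonUnitalSubalgebra.toSubmodule.topologicalClosure
  have hC : (C : Set R) = closure (P : Set R) := rfl
  -- The right multipliers of the closure form a closed unital `*`-algebra even when `P` has no
  -- unit, so functional calculus stays inside it.
  let S : StarSubalgebra ℂ R :=
    { carrier := {c | ∀ z ∈ C, z * c ∈ C ∧ z * star c ∈ C}
      mul_mem' := fun {c d} hc hd z hz => by
        refine ⟨?_, ?_⟩
        · rw [← mul_assoc]; exact (hd _ (hc z hz).1).1
        · rw [star_mul, ← mul_assoc]; exact (hc _ (hd z hz).2).2
      add_mem' := fun {c d} hc hd z hz => by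
        refine ⟨?_, ?_⟩
        · rw [mul_add]; exact C.add_mem (hc z hz).1 (hd z hz).1
        · rw [star_add, mul_add]; exact C.add_mem (hc z hz).2 (hd z hz).2
      algebraMap_mem' := fun r z hz => by
        refine ⟨?_, ?_⟩
        · rw [← Algebra.commutes, ← Algebra.smul_def]; exact C.smul_mem _ hz
        · rw [← algebraMap_star_comm, ← Algebra.commutes, ← Algebra.smul_def]
          exact C.smul_mem _ hz
      star_mem' := fun {c} hc z hz => ⟨(hc z hz).2, by rw [star_star]; exact (hc z hz).1⟩ }
  have hS : IsClosed (S : Set R) := by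
    have : (S : Set R) = ⋂ z ∈ C, {c | z * c ∈ C} ∩ {c | z * star c ∈ C} := by
      ext c; simp [S]
    rw [this]
    have hCc : IsClosed (C : Set R) := Submodule.isClosed_topologicalClosure _
    refine isClosed_biInter fun z _ => (hCc.preimage ?_).inter (hCc.preimage ?_) <;> fun_prop
  have haS : a ∈ S := fun z hz =>
    ⟨hcl hz (subset_closure ha), hcl hz (subset_closure (star_mem ha))⟩
  exact (cfc_mem (s := S) (𝕜' := ℂ) f haS z (subset_closure hz)).1

namespace IsTraceState

variable {τ : StrongDual ℂ R}

/-- Polarization: the values at `1 + x` and `1 + i x` being real determines the imaginary and the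
real part. -/
theorem map_star (hτ : IsTraceState τ) (x : R) : τ (star x) = star (τ x) := by
  have h1 := (hτ.nonneg (1 + x)).2
  have h2 := (hτ.nonneg (1 + Complex.I • x)).2
  have hx := (hτ.nonneg x).2
  simp only [star_add, star_one, star_smul, add_mul, mul_add, one_mul, mul_one, map_add, hτ.map_one,
    smul_mul_assoc, mul_smul_comm, map_smul, Complex.add_im, hx] at h1 h2
  simp at h1 h2
  apply Complex.ext
  · simp; linarith
  · simp; linarith

theorem l2Sq_nonneg (hτ : IsTraceState τ) (x : R) : 0 ≤ l2Sq τ x := (hτ.nonneg x).1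

theorem apply_star_mul_self (hτ : IsTraceState τ) (x : R) : τ (star x * x) = l2Sq τ x :=
  Complex.ext rfl (hτ.nonneg x).2

theorem cauchy_schwarz (hτ : IsTraceState τ) (x y : R) :
    ‖τ (star x * y)‖ ^ 2 ≤ l2Sq τ x * l2Sq τ y := by
  let c : PreInnerProductSpace.Core ℂ R :=
    { inner := fun x y => τ (star x * y)
      conj_inner_symm := fun x y => by
        have := hτ.map_star (star y * x)
        rw [star_mul, star_star] at this
        exact this.symm
      re_inner_nonneg := fun x => (hτ.nonneg x).1
      add_left := fun x y z => by simp [add_mul]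
      smul_left := fun x y r => by simp }
  have h := @InnerProductSpace.Core.inner_mul_inner_self_le ℂ R _ _ _ c x y
  have h2 : ‖τ (star y * x)‖ = ‖τ (star x * y)‖ := by
    rw [← norm_star, ← hτ.map_star, star_mul, star_star]
  have h3 : ‖τ (star x * y)‖ * ‖τ (star y * x)‖ ≤ l2Sq τ x * l2Sq τ y := h
  rwa [h2, ← sq] at h3

/-- Write `‖c‖² - c* c = d* d` and use positivity of `τ` at `d x`. -/
theorem l2Sq_mul_le [CompleteSpace R] (hτ : IsTraceState τ) (c x : R) :
    l2Sq τ (c * x) ≤ ‖c‖ ^ 2 * l2Sq τ x := by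
  let _ : CStarAlgebra R := {}
  let _ : PartialOrder R := CStarAlgebra.spectralOrder R
  have _ : StarOrderedRing R := CStarAlgebra.spectralOrderedRing R
  have h := CStarAlgebra.star_mul_le_algebraMap_norm_sq (a := c)
  rw [← sub_nonneg, CStarAlgebra.nonneg_iff_eq_star_mul_self] at h
  obtain ⟨d, hd⟩ := h
  have h1 := (hτ.nonneg (d * x)).1
  have h2 : star (d * x) * (d * x) = (‖c‖ ^ 2 : ℂ) • (star x * x) - star (c * x) * (c * x) := by
    calc star (d * x) * (d * x) = star x * (star d * d) * x := by simp only [star_mul, mul_assoc]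
      _ = (‖c‖ ^ 2 : ℂ) • (star x * x) - star (c * x) * (c * x) := by
        rw [← hd]
        simp only [star_mul, mul_sub, sub_mul, mul_assoc, Algebra.algebraMap_eq_smul_one]
        simp [← Complex.coe_smul]
  rw [h2, map_sub, map_smul, smul_eq_mul, hτ.apply_star_mul_self, hτ.apply_star_mul_self] at h1
  have h3 : ((‖c‖ ^ 2 : ℂ) * (l2Sq τ x : ℂ) - (l2Sq τ (c * x) : ℂ)).re =
      ‖c‖ ^ 2 * l2Sq τ x - l2Sq τ (c * x) := by
    norm_cast
  linarith [h3 ▸ h1]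

theorem l2Sq_one (hτ : IsTraceState τ) : l2Sq τ 1 = 1 := by simp [l2Sq, hτ.map_one]

theorem l2Sq_le [CompleteSpace R] (hτ : IsTraceState τ) (c : R) : l2Sq τ c ≤ ‖c‖ ^ 2 := by
  simpa [hτ.l2Sq_one] using hτ.l2Sq_mul_le c 1

theorem norm_apply_le [CompleteSpace R] (hτ : IsTraceState τ) (c : R) : ‖τ c‖ ≤ ‖c‖ := by
  have h := hτ.cauchy_schwarz 1 c
  rw [star_one, one_mul, hτ.l2Sq_one, one_mul] at h
  exact abs_le_of_sq_le_sq' (h.trans (hτ.l2Sq_le c)) (norm_nonneg _) |>.2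

theorem l2Sq_smul (hτ : IsTraceState τ) (r : ℂ) (x : R) : l2Sq τ (r • x) = ‖r‖ ^ 2 * l2Sq τ x := by
  have : star (r • x) * (r • x) = ((‖r‖ ^ 2 : ℝ) : ℂ) • (star x * x) := by
    rw [star_smul, smul_mul_assoc, mul_smul_comm, smul_smul]
    congr 1
    simp [Complex.conj_mul']
  rw [l2Sq, this, map_smul, smul_eq_mul, hτ.apply_star_mul_self, ← Complex.ofReal_mul,
    Complex.ofReal_re]

theorem l2Sq_sub (hτ : IsTraceState τ) (x y : R) :
    l2Sq τ (x - y) = l2Sq τ x - 2 * (τ (star y * x)).re + l2Sq τ y := by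
  have h : τ (star x * y) = star (τ (star y * x)) := by rw [← hτ.map_star, star_mul, star_star]
  simp only [l2Sq, star_sub, sub_mul, mul_sub, map_sub, h]
  simp
  ring

/-- Approximate orthogonal projection, in the `L²`-seminorm, onto a subspace. -/
theorem exists_l2_approx (hτ : IsTraceState τ) (N : Submodule ℂ R) (x : R) {ε : ℝ} (hε : 0 < ε) :
    ∃ a ∈ N, ∀ n ∈ N, ‖τ (star n * (x - a))‖ ^ 2 ≤ ε * l2Sq τ n := by
  have hbdd : BddBelow ((fun a => l2Sq τ (x - a)) '' N) :=
    ⟨0, by rintro _ ⟨a, _, rfl⟩; exact hτ.l2Sq_nonneg _⟩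
  have hne : ((fun a => l2Sq τ (x - a)) '' N).Nonempty := ⟨_, 0, N.zero_mem, rfl⟩
  obtain ⟨_, ⟨a, ha, rfl⟩, h⟩ := exists_lt_of_csInf_lt hne (lt_add_of_pos_right _ hε)
  refine ⟨a, ha, fun n hn => ?_⟩
  set w := τ (star n * (x - a)) with hw
  rcases (hτ.l2Sq_nonneg n).eq_or_lt with h0 | h0
  · have := hτ.cauchy_schwarz n (x - a)
    rw [← h0, zero_mul] at this
    rwa [← h0, mul_zero]
  -- Moving `a` by the optimal multiple of `n` lowers the squared distance by `‖w‖² / l2Sq τ n`,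
  -- which cannot exceed `ε` because `a` is within `ε` of the infimum.
  · have h1 := csInf_le hbdd ⟨a + (w / l2Sq τ n) • n, N.add_mem ha (N.smul_mem _ hn), rfl⟩
    have h2 : l2Sq τ (x - (a + (w / l2Sq τ n) • n)) = l2Sq τ (x - a) - ‖w‖ ^ 2 / l2Sq τ n := by
      rw [← sub_sub, hτ.l2Sq_sub, hτ.l2Sq_smul, star_smul, smul_mul_assoc, map_smul, ← hw]
      have h3 : (star (w / (l2Sq τ n : ℂ)) • w).re = ‖w‖ ^ 2 / l2Sq τ n := by
        have : star (w / (l2Sq τ n : ℂ)) • w = ((‖w‖ ^ 2 / l2Sq τ n : ℝ) : ℂ) := by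
          simp only [smul_eq_mul, Complex.star_def, map_div₀, Complex.conj_ofReal]
          rw [div_mul_eq_mul_div, Complex.conj_mul']
          push_cast
          rfl
        rw [this, Complex.ofReal_re]
      rw [h3, norm_div, Complex.norm_real, Real.norm_of_nonneg h0.le]
      field_simp
      ring
    have h3 : ‖w‖ ^ 2 / l2Sq τ n ≤ ε := by
      simp only [h2] at h1
      linarith
    rwa [div_le_iff₀ h0] at h3

end IsTraceState

end TraceState

/-! ### Norm approximation in Banach duals -/

section Dual

variable {E : Type*} [NormedAddCommGroup E] [NormedSpace ℂ E]

theorem mem_closure_dual_iff {S : Set (StrongDual ℂ E)} {ξ : StrongDual ℂ E} :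
    ξ ∈ closure S ↔ ∀ δ > 0, ∃ η ∈ S, ∀ y, ‖ξ y - η y‖ ≤ δ * ‖y‖ := by
  rw [Metric.mem_closure_iff]
  constructor
  · intro h δ hδ
    obtain ⟨η, hη, h1⟩ := h δ hδ
    rw [dist_eq_norm] at h1
    exact ⟨η, hη, fun y => ((ξ - η).le_opNorm y).trans (by gcongr)⟩
  · intro h δ hδ
    obtain ⟨η, hη, h1⟩ := h (δ / 2) (half_pos hδ)
    refine ⟨η, hη, ?_⟩
    rw [dist_eq_norm]
    exact ((ξ - η).opNorm_le_bound (half_pos hδ).le h1).trans_lt (half_lt_self hδ)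

theorem exists_dual_limit (f : ℕ → StrongDual ℂ E) {C : ℝ} (hC : 0 ≤ C)
    (h : ∀ k y, ‖f k y - f (k + 1) y‖ ≤ C * (1 / 2) ^ k * ‖y‖) :
    ∃ η : StrongDual ℂ E, η ∈ closure (Set.range f) ∧
      ∀ y, Filter.Tendsto (fun k => f k y) Filter.atTop (nhds (η y)) := by
  have hcauchy : CauchySeq f := cauchySeq_of_le_geometric (1 / 2) C (by norm_num) fun k => by
    rw [dist_eq_norm]
    exact (f k - f (k + 1)).opNorm_le_bound (by positivity) (h k)
  obtain ⟨η, hη⟩ := cauchySeq_tendsto_of_complete hcauchy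
  exact ⟨η, mem_closure_of_tendsto hη (Filter.Eventually.of_forall fun k => ⟨k, rfl⟩), fun y =>
    ((ContinuousLinearMap.apply ℂ ℂ y).continuous.tendsto _).comp hη⟩

end Dual

/-! ### The `L¹`-norm, and conditional expectations on `L¹` -/

section L1Norm

variable {R : Type*} [NormedRing R] [StarRing R] [CStarRing R] [NormedAlgebra ℂ R]
  [StarModule ℂ R]

namespace IsTraceState

variable {τ : StrongDual ℂ R}

/-- An approximate polar decomposition of `x`: a contraction `v` with `x = v h`, where
`h = (ε + x* x)^{1/2}`, together with the resulting estimates of traces. -/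
theorem exists_approx_polar [CompleteSpace R] (hτ : IsTraceState τ) (P : NonUnitalStarSubalgebra ℂ R)
    {x : R} (hx : x ∈ P) {ε : ℝ} (hε : 0 < ε) :
    ∃ u ∈ closure (P : Set R), ‖u‖ ≤ 1 ∧ ∀ y, ‖τ (x * y)‖ ≤ ‖y‖ * (‖τ (x * u)‖ + √ε) := by
  let _ : CStarAlgebra R := {}
  let a := star x * x
  have ha : IsSelfAdjoint a := IsSelfAdjoint.star_mul_self x
  have hpos : ∀ t ∈ spectrum ℝ a, 0 ≤ t := spectrum_star_mul_self_nonneg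
  -- A fourth root: `s = g(a)` satisfies `s⁴ = ε + x* x`, so `h = s²` and `r = s⁻¹`. The absolute
  -- value only makes `g` continuous and positive on all of `ℝ`.
  let g : ℝ → ℝ := fun t => √√(ε + |t|)
  have hg : Continuous g := by fun_prop
  have hg0 : ∀ t, 0 < g t := fun t => by positivity
  have hgi : Continuous fun t => (g t)⁻¹ := hg.inv₀ fun t => (hg0 t).ne'
  have hgg : Continuous fun t => g t * g t := hg.mul hg
  have hgigi : Continuous fun t => (g t)⁻¹ * (g t)⁻¹ := hgi.mul hgi
  have hgit : Continuous fun t => (g t)⁻¹ * (g t)⁻¹ * t := hgigi.mul continuous_id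
  have hg4 : ∀ t, 0 ≤ t → g t * g t * (g t * g t) = ε + t := by
    intro t ht
    simp only [g]
    rw [Real.mul_self_sqrt (by positivity), Real.mul_self_sqrt (by positivity), abs_of_nonneg ht]
  have hg2 : ∀ t, √ε ≤ g t * g t := fun t => by
    simp only [g]
    rw [Real.mul_self_sqrt (by positivity)]
    exact Real.sqrt_le_sqrt (by linarith [abs_nonneg t])
  let s := cfc g a
  let r := cfc (fun t => (g t)⁻¹) a
  have hs : star s = s := (cfc_predicate g a : IsSelfAdjoint s)
  have hr : star r = r := (cfc_predicate _ a : IsSelfAdjoint r)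
  have hrs : r * s = 1 := by
    rw [← cfc_mul _ _ a hgi.continuousOn hg.continuousOn, ← cfc_one ℝ a]
    exact cfc_congr fun t _ => inv_mul_cancel₀ (hg0 t).ne'
  have hs4 : s * s * (s * s) = ε • 1 + a := by
    have h1 : ε • (1 : R) + a = cfc (fun t => ε + t) a := by
      rw [cfc_const_add ε (fun t => t) a (by fun_prop), cfc_id' ℝ a, Algebra.algebraMap_eq_smul_one]
    rw [h1, ← cfc_mul _ _ a hg.continuousOn hg.continuousOn,
      ← cfc_mul _ _ a hgg.continuousOn hgg.continuousOn]
    exact cfc_congr fun t ht => hg4 t (hpos t ht)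
  have hrr : ‖r * r‖ ≤ (√ε)⁻¹ := by
    rw [← cfc_mul _ _ a hgi.continuousOn hgi.continuousOn]
    refine norm_cfc_le (by positivity) fun t _ => ?_
    rw [← mul_inv, norm_inv, Real.norm_of_nonneg (mul_pos (hg0 t) (hg0 t)).le]
    exact inv_anti₀ (by positivity) (hg2 t)
  let v := x * (r * r)
  have hv : ‖v‖ ≤ 1 := by
    have h1 : star v * v = cfc (fun t => (g t)⁻¹ * (g t)⁻¹ * t * ((g t)⁻¹ * (g t)⁻¹)) a := by
      rw [cfc_mul _ _ a hgit.continuousOn hgigi.continuousOn,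
        cfc_mul _ (fun t => t) a hgigi.continuousOn continuousOn_id, cfc_mul _ _ a hgi.continuousOn hgi.continuousOn, cfc_id' ℝ a]
      simp only [v, star_mul, hr, mul_assoc, a, r]
    have h2 : ‖star v * v‖ ≤ 1 := by
      rw [h1]
      refine norm_cfc_le zero_le_one fun t ht => ?_
      have h3 : (g t)⁻¹ * (g t)⁻¹ * t * ((g t)⁻¹ * (g t)⁻¹) = t / (ε + t) := by
        rw [← hg4 t (hpos t ht)]
        have := (hg0 t).ne'
        field_simp
      have h4 : 0 < ε + t := add_pos_of_pos_of_nonneg hε (hpos t ht)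
      rw [h3, Real.norm_of_nonneg (div_nonneg (hpos t ht) h4.le), div_le_one h4]
      linarith
    rw [CStarRing.norm_star_mul_self] at h2
    nlinarith [norm_nonneg v]
  have hxv : x = v * s * s := by
    simp only [v]
    calc x = x * (r * (r * s) * s) := by rw [hrs, mul_one, hrs, mul_one]
      _ = _ := by simp only [mul_assoc]
  -- This is `v* x = h - ε h⁻¹`. As `‖h⁻¹‖ ≤ ε^{-1/2}`, the trace of `h` exceeds `|τ(x v*)|` by at
  -- most `√ε`.
  have hraa : star v * x = s * s - ε • (r * r) := by
    have h1 : star v * x = r * r * a := by simp only [v, star_mul, hr, a, mul_assoc]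
    have h2 : a = s * s * (s * s) - ε • 1 := by rw [hs4]; abel
    have h3 : r * r * (s * s * (s * s)) = s * s := by
      calc r * r * (s * s * (s * s)) = r * (r * s) * s * (s * s) := by simp only [mul_assoc]
        _ = s * s := by rw [hrs, mul_one, hrs, one_mul]
    rw [h1, h2, mul_sub, h3, mul_smul_comm, mul_one]
  have hl2 : l2Sq τ s = (τ (s * s)).re := by rw [l2Sq, hs]
  have hvx : l2Sq τ s ≤ ‖τ (x * star v)‖ + √ε := by
    have h1 : τ (s * s) = τ (x * star v) + (ε : ℂ) • τ (r * r) := by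
      rw [hτ.trace x, hraa, ← map_smul, ← map_add, Complex.coe_smul, sub_add_cancel]
    calc l2Sq τ s ≤ ‖τ (s * s)‖ := hl2 ▸ Complex.re_le_norm _
      _ ≤ ‖τ (x * star v)‖ + ‖(ε : ℂ) • τ (r * r)‖ := h1 ▸ norm_add_le _ _
      _ ≤ ‖τ (x * star v)‖ + ε * (√ε)⁻¹ := by
        rw [norm_smul, Complex.norm_real, Real.norm_of_nonneg hε.le]
        gcongr
        exact (hτ.norm_apply_le _).trans hrr
      _ = ‖τ (x * star v)‖ + √ε := by rw [← div_eq_mul_inv, Real.div_sqrt]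
  refine ⟨star v, ?_, by rwa [norm_star], fun y => ?_⟩
  · have h1 : v ∈ closure (P : Set R) := by
      have h2 : v = x * cfc (fun t => (g t)⁻¹ * (g t)⁻¹) a := by
        rw [cfc_mul _ _ a hgi.continuousOn hgi.continuousOn]
      rw [h2]
      exact mul_cfc_mem_closure P hx (mul_mem (star_mem hx) hx) _
    exact map_mem_closure continuous_star h1 fun _ h => star_mem h
  -- Distributing `h = s s` over both ends of the trace and applying Cauchy–Schwarz bounds `|τ(x
  -- y)|` by `‖y‖ τ(h)`.
  · have h1 : τ (x * y) = τ (star s * (y * v * s)) := by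
      rw [hs]
      calc τ (x * y) = τ (v * s * (s * y)) := by
            conv_lhs => rw [hxv]
            simp only [mul_assoc]
        _ = τ (s * (y * v * s)) := by rw [hτ.trace]; simp only [mul_assoc]
    have h2 := hτ.cauchy_schwarz s (y * v * s)
    have h3 := hτ.l2Sq_mul_le (y * v) s
    have h0 := hτ.l2Sq_nonneg s
    have h4 : ‖y * v‖ ≤ ‖y‖ := (norm_mul_le _ _).trans (mul_le_of_le_one_right (norm_nonneg _) hv)
    have h5 : ‖τ (x * y)‖ ≤ ‖y‖ * l2Sq τ s := by
      rw [h1]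
      refine abs_le_of_sq_le_sq' (h2.trans ?_) (by positivity) |>.2
      calc l2Sq τ s * l2Sq τ (y * v * s) ≤ l2Sq τ s * (‖y * v‖ ^ 2 * l2Sq τ s) := by gcongr
        _ ≤ l2Sq τ s * (‖y‖ ^ 2 * l2Sq τ s) := by gcongr
        _ = (‖y‖ * l2Sq τ s) ^ 2 := by ring
    exact h5.trans (by gcongr)

/-- The `L¹`-norm of an element of a `*`-subalgebra is determined by that subalgebra. -/
theorem norm_apply_mul_le [CompleteSpace R] (hτ : IsTraceState τ) (P : NonUnitalStarSubalgebra ℂ R)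
    {x : R} (hx : x ∈ P) {C : ℝ} (hC0 : 0 ≤ C)
    (hC : ∀ n ∈ P, ‖τ (x * n)‖ ≤ C * ‖n‖) (y : R) :
    ‖τ (x * y)‖ ≤ C * ‖y‖ := by
  have hcl : ∀ n ∈ closure (P : Set R), ‖τ (x * n)‖ ≤ C * ‖n‖ := fun n hn =>
    closure_minimal (s := (P : Set R)) (t := {n | ‖τ (x * n)‖ ≤ C * ‖n‖}) hC
      (isClosed_le (by fun_prop) (by fun_prop)) hn
  have key : ∀ δ > 0, ‖τ (x * y)‖ ≤ C * ‖y‖ + ‖y‖ * δ := by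
    intro δ hδ
    obtain ⟨u, hu, hu1, h⟩ := hτ.exists_approx_polar P hx (pow_pos hδ 2)
    have h2 := hcl u hu
    have h3 := h y
    rw [Real.sqrt_sq hδ.le] at h3
    have : ‖τ (x * u)‖ ≤ C := h2.trans (mul_le_of_le_one_right hC0 hu1)
    nlinarith [norm_nonneg y]
  refine le_of_forall_pos_le_add fun δ hδ => ?_
  have h1 := key (δ / (‖y‖ + 1)) (by positivity)
  refine h1.trans (add_le_add le_rfl ?_)
  rw [mul_div_assoc', div_le_iff₀ (by positivity)]
  nlinarith [norm_nonneg y]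

/-- The normalized form of `norm_apply_mul_le`. If `τ e = 0`, the inverse is `0` by convention and
the bound is trivial. -/
theorem norm_toL1_le [CompleteSpace R] (hτ : IsTraceState τ) (P : NonUnitalStarSubalgebra ℂ R)
    (e : R) {x : R} (hx : x ∈ P) {C : ℝ} (hC0 : 0 ≤ C)
    (hC : ∀ n ∈ P, ‖(τ e)⁻¹ * τ (x * n)‖ ≤ C * ‖n‖) (y : corner e) :
    ‖toL1 τ e x y‖ ≤ C * ‖y‖ := by
  rw [toL1_apply]
  rcases eq_or_ne (τ e) 0 with h0 | h0
  · rw [h0, inv_zero, zero_mul, norm_zero]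
    positivity
  · have h1 : 0 < ‖τ e‖ := norm_pos_iff.2 h0
    have h2 := hτ.norm_apply_mul_le P hx (C := ‖τ e‖ * C) (by positivity) (fun n hn => by
      have h3 := hC n hn
      rw [norm_mul, norm_inv, inv_mul_le_iff₀ h1] at h3
      rwa [mul_assoc]) y
    rw [norm_mul, norm_inv, inv_mul_le_iff₀ h1, ← mul_assoc]
    exact h2

/-- An element of `L¹(P)` is determined by its values on `P`. -/
theorem eq_of_mem_L1 [CompleteSpace R] (hτ : IsTraceState τ)
    (P : NonUnitalStarSubalgebra ℂ R) {e : R} (hP : ∀ n ∈ P, n ∈ corner e)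
    {ξ η : StrongDual ℂ (corner e)} (hξ : ξ ∈ L1 τ e (P : Set R)) (hη : η ∈ L1 τ e (P : Set R))
    (h0 : ∀ n (hn : n ∈ P), ξ ⟨n, hP n hn⟩ = η ⟨n, hP n hn⟩) : ξ = η := by
  refine ContinuousLinearMap.ext fun y => ?_
  refine sub_eq_zero.1 (norm_le_zero_iff.1 (le_of_forall_pos_le_add fun δ hδ => ?_))
  let κ := δ / (4 * (‖y‖ + 1))
  have hκ : 0 < κ := by positivity
  obtain ⟨_, ⟨x, hx, rfl⟩, h1⟩ := mem_closure_dual_iff.1 hξ κ hκ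
  obtain ⟨_, ⟨z, hz, rfl⟩, h2⟩ := mem_closure_dual_iff.1 hη κ hκ
  -- On `P` the approximants `x` and `z` are close because `ξ` and `η` agree there; since `x - z`
  -- lies in `P`, closeness on `P` is closeness everywhere.
  have h3 : ‖toL1 τ e (x - z) y‖ ≤ 2 * κ * ‖y‖ := by
    refine hτ.norm_toL1_le P e (sub_mem hx hz) (by positivity) (fun n hn => ?_) y
    have h4 : (τ e)⁻¹ * τ ((x - z) * n) = (η ⟨n, hP n hn⟩ - toL1 τ e z ⟨n, hP n hn⟩) -
        (ξ ⟨n, hP n hn⟩ - toL1 τ e x ⟨n, hP n hn⟩) := by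
      rw [h0 n hn, toL1_apply, toL1_apply, sub_mul, map_sub]; ring
    rw [h4]
    refine (norm_sub_le _ _).trans ((add_le_add (h2 _) (h1 _)).trans (le_of_eq ?_))
    rw [Submodule.coe_norm]
    ring
  have h5 : ξ y - η y = (ξ y - toL1 τ e x y) - (η y - toL1 τ e z y) + toL1 τ e (x - z) y := by
    rw [toL1_apply, toL1_apply, toL1_apply, sub_mul, map_sub]; ring
  rw [h5]
  refine (norm_add_le _ _).trans ((add_le_add ((norm_sub_le _ _).trans
    (add_le_add (h1 y) (h2 y))) h3).trans ?_)
  have h6 : κ * ‖y‖ + κ * ‖y‖ + 2 * κ * ‖y‖ = δ * (‖y‖ / (‖y‖ + 1)) := by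
    simp only [κ]; field_simp; ring
  rw [h6, zero_add]
  refine mul_le_of_le_one_right hδ.le ?_
  rw [div_le_one (by positivity)]
  linarith

/-- Existence of the conditional expectation on `L¹`. -/
theorem exists_condExp_L1 [CompleteSpace R] (hτ : IsTraceState τ)
    (P : NonUnitalStarSubalgebra ℂ R) {e : R} (hP : ∀ n ∈ P, n ∈ corner e)
    {ξ : StrongDual ℂ (corner e)} (hξ : ξ ∈ L1 τ e (Set.univ : Set R)) :
    ∃ η ∈ L1 τ e (P : Set R), ∀ n (hn : n ∈ P), η ⟨n, hP n hn⟩ = ξ ⟨n, hP n hn⟩ := by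
  -- Approximate `ξ` by some `x`, then project `x` approximately onto `P` in `L²`; the pairings with
  -- `P` hardly change.
  have key : ∀ δ > 0, ∃ a ∈ P, ∀ n (hn : n ∈ P),
      ‖toL1 τ e a ⟨n, hP n hn⟩ - ξ ⟨n, hP n hn⟩‖ ≤ δ * ‖n‖ := by
    intro δ hδ
    obtain ⟨_, ⟨x, -, rfl⟩, h⟩ := mem_closure_dual_iff.1 hξ (δ / 2) (by positivity)
    let κ := δ / (2 * (‖(τ e)⁻¹‖ + 1))
    have hκ : 0 < κ := by positivity
    obtain ⟨a, ha, h1⟩ := hτ.exists_l2_approx P.toNonUnitalSubalgebra.toSubmodule x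
      (pow_pos hκ 2)
    refine ⟨a, ha, fun n hn => ?_⟩
    have h2 : ‖τ ((x - a) * n)‖ ≤ κ * ‖n‖ := by
      have h3 := h1 (star n) (star_mem (S := NonUnitalStarSubalgebra ℂ R) hn)
      rw [star_star] at h3
      have h4 := hτ.l2Sq_le (star n)
      rw [norm_star] at h4
      rw [hτ.trace]
      refine abs_le_of_sq_le_sq' (h3.trans ?_) (by positivity) |>.2
      rw [mul_pow]
      gcongr
    have h3 : ‖toL1 τ e x ⟨n, hP n hn⟩ - toL1 τ e a ⟨n, hP n hn⟩‖ ≤ δ / 2 * ‖n‖ := by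
      rw [toL1_apply, toL1_apply, ← mul_sub, ← map_sub, ← sub_mul, norm_mul]
      calc ‖(τ e)⁻¹‖ * ‖τ ((x - a) * n)‖ ≤ ‖(τ e)⁻¹‖ * (κ * ‖n‖) := by gcongr
        _ ≤ (‖(τ e)⁻¹‖ + 1) * (κ * ‖n‖) := by gcongr; linarith
        _ = δ / 2 * ‖n‖ := by simp only [κ]; field_simp
    have h4 : ‖ξ ⟨n, hP n hn⟩ - toL1 τ e x ⟨n, hP n hn⟩‖ ≤ δ / 2 * ‖n‖ := h ⟨n, hP n hn⟩
    rw [norm_sub_rev]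
    exact (norm_sub_le_norm_sub_add_norm_sub _ _ _).trans ((add_le_add h4 h3).trans (by linarith))
  choose! a ha hab using fun k : ℕ => key ((1 / 2) ^ k) (by positivity)
  -- Consecutive differences lie in `P`, so their small pairings with `P` make the sequence Cauchy
  -- in norm.
  obtain ⟨η, hη, hlim⟩ := exists_dual_limit (fun k => toL1 τ e (a k)) (C := 2) (by norm_num)
    (fun k y => by
      have h1 : toL1 τ e (a k) y - toL1 τ e (a (k + 1)) y = toL1 τ e (a k - a (k + 1)) y := by
        rw [toL1_apply, toL1_apply, toL1_apply, sub_mul, map_sub]; ring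
      rw [h1]
      refine hτ.norm_toL1_le P e (sub_mem (ha k) (ha (k + 1))) (by positivity) (fun n hn => ?_) y
      have h2 : (τ e)⁻¹ * τ ((a k - a (k + 1)) * n) =
          (toL1 τ e (a k) ⟨n, hP n hn⟩ - ξ ⟨n, hP n hn⟩) -
            (toL1 τ e (a (k + 1)) ⟨n, hP n hn⟩ - ξ ⟨n, hP n hn⟩) := by
        rw [toL1_apply, toL1_apply, sub_mul, map_sub]; ring
      rw [h2]
      refine (norm_sub_le _ _).trans ((add_le_add (hab k n hn) (hab (k + 1) n hn)).trans ?_)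
      rw [pow_succ, ← add_mul]
      gcongr
      nlinarith [pow_pos (show (0 : ℝ) < 1 / 2 by norm_num) k])
  refine ⟨η, closure_mono ?_ hη, fun n hn => ?_⟩
  · rintro _ ⟨k, rfl⟩
    exact ⟨a k, ha k, rfl⟩
  have h2 : Filter.Tendsto (fun k : ℕ => (1 / 2 : ℝ) ^ k * ‖n‖) Filter.atTop (nhds 0) := by
    simpa using (tendsto_pow_atTop_nhds_zero_of_lt_one (by norm_num : (0 : ℝ) ≤ 1 / 2)
      (by norm_num)).mul_const ‖n‖
  exact sub_eq_zero.1 (tendsto_nhds_unique ((hlim ⟨n, hP n hn⟩).sub_const _)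
    (squeeze_zero_norm (fun k => hab k n hn) h2))

end IsTraceState

end L1Norm

/-! ### Nearest points in balls of a subalgebra -/

section CondExp

variable {R : Type*} [NormedRing R] [StarRing R] [CStarRing R] [NormedAlgebra ℂ R]
  [StarModule ℂ R]

namespace IsTraceState

variable {τ : StrongDual ℂ R}

/-- Variational inequality for the point `b₀` of a ball in `B` nearest to `a`. -/
theorem re_le_of_isMin (hτ : IsTraceState τ) (B : NonUnitalStarSubalgebra ℂ R) {a b₀ : R} {r : ℝ}
    (hb₀ : b₀ ∈ B) (hn : ‖b₀‖ ≤ r)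
    (hmin : ∀ b ∈ B, ‖b‖ ≤ r → l2Sq τ (a - b₀) ≤ l2Sq τ (a - b)) {b : R} (hb : b ∈ B)
    (hbr : ‖b‖ ≤ r) : (τ (star b * (a - b₀))).re ≤ (τ (star b₀ * (a - b₀))).re := by
  set y := a - b₀ with hy
  set z := b - b₀ with hz
  -- The segment from `b₀` to `b` stays in the ball; compare distances along it and let `s` tend to
  -- `0`.
  have key : ∀ s : ℝ, 0 < s → s ≤ 1 → 2 * (τ (star z * y)).re ≤ s * l2Sq τ z := by
    intro s hs hs1
    have h1 : b₀ + (s : ℂ) • z = ((1 - s : ℝ) : ℂ) • b₀ + (s : ℂ) • b := by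
      simp only [hz, smul_sub, Complex.ofReal_sub, Complex.ofReal_one, sub_smul, one_smul]; abel
    have h2 : ‖b₀ + (s : ℂ) • z‖ ≤ r := by
      rw [h1]
      refine (norm_add_le _ _).trans ?_
      rw [norm_smul, norm_smul, Complex.norm_real, Complex.norm_real, Real.norm_of_nonneg hs.le,
        Real.norm_of_nonneg (sub_nonneg.2 hs1)]
      nlinarith
    have h3 := hmin _ (add_mem hb₀ (SMulMemClass.smul_mem (s : ℂ) (sub_mem hb hb₀))) h2
    rw [← sub_sub, hτ.l2Sq_sub _ ((s : ℂ) • z), hτ.l2Sq_smul, star_smul, smul_mul_assoc, map_smul,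
      Complex.norm_real, Real.norm_of_nonneg hs.le] at h3
    have h4 : (star (s : ℂ) • τ (star z * (a - b₀))).re = s * (τ (star z * y)).re := by
      simp [hy]
    rw [h4] at h3
    have h5 : s * (2 * (τ (star z * y)).re) ≤ s * (s * l2Sq τ z) := by linarith
    exact le_of_mul_le_mul_left h5 hs
  have h6 : 2 * (τ (star z * y)).re ≤ 0 := by
    refine le_of_forall_pos_le_add fun δ hδ => ?_
    have h0 := hτ.l2Sq_nonneg z
    refine (key (min 1 (δ / (l2Sq τ z + 1))) (by positivity) (min_le_left _ _)).trans ?_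
    calc min 1 (δ / (l2Sq τ z + 1)) * l2Sq τ z ≤ δ / (l2Sq τ z + 1) * (l2Sq τ z + 1) := by
          gcongr
          · exact min_le_right _ _
          · linarith
      _ = 0 + δ := by field_simp; ring
  have h7 : τ (star z * y) = τ (star b * y) - τ (star b₀ * y) := by
    rw [hz, star_sub, sub_mul, map_sub]
  rw [h7, Complex.sub_re] at h6
  linarith

/-- If `b₀` is a point nearest to `a` in the ball `{b ∈ B : ‖b‖ ≤ ‖a‖}`, then `a - b₀` is
orthogonal to `B`. -/
theorem apply_star_mul_eq_zero_of_isMin [CompleteSpace R] (hτ : IsTraceState τ)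
    (B : NonUnitalStarSubalgebra ℂ R) {a b₀ : R}
    (hb₀ : b₀ ∈ B) (hn : ‖b₀‖ ≤ ‖a‖)
    (hmin : ∀ b ∈ B, ‖b‖ ≤ ‖a‖ → l2Sq τ (a - b₀) ≤ l2Sq τ (a - b)) {n : R} (hnB : n ∈ B) :
    τ (star n * (a - b₀)) = 0 := by
  rcases eq_or_ne a 0 with rfl | ha
  · have : b₀ = 0 := by simpa using hn
    simp [this]
  have hr : 0 < ‖a‖ := norm_pos_iff.2 ha
  set r := ‖a‖
  set y := a - b₀ with hy
  set β := (τ (star b₀ * y)).re with hβ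
  have hvar : ∀ b ∈ B, ‖b‖ ≤ r → (τ (star b * y)).re ≤ β := fun b hb hbr =>
    hτ.re_le_of_isMin B hb₀ hn hmin hb hbr
  have hβ0 : 0 ≤ β := by simpa using hvar 0 (zero_mem B) (by simpa using hr.le)
  have hvar' : ∀ m ∈ B, r * ‖τ (star m * y)‖ ≤ β * ‖m‖ := by
    intro m hm
    rcases eq_or_ne m 0 with rfl | hm0
    · simp
    have hm1 : 0 < ‖m‖ := norm_pos_iff.2 hm0
    set w := τ (star m * y) with hw
    rcases eq_or_ne w 0 with h0 | h0
    · rw [h0, norm_zero, mul_zero]; positivity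
    have hw1 : 0 < ‖w‖ := norm_pos_iff.2 h0
    have h1 := hvar (((r / ‖m‖ / ‖w‖ : ℝ) * w : ℂ) • m) (SMulMemClass.smul_mem _ hm) (by
      rw [norm_smul, norm_mul, Complex.norm_real, Real.norm_of_nonneg (by positivity)]
      apply le_of_eq; field_simp)
    rw [star_smul, smul_mul_assoc, map_smul, ← hw] at h1
    have h2 : star ((r / ‖m‖ / ‖w‖ : ℝ) * w : ℂ) • w = ((r / ‖m‖ * ‖w‖ : ℝ) : ℂ) := by
      rw [smul_eq_mul, Complex.star_def, map_mul, Complex.conj_ofReal, mul_assoc, Complex.conj_mul']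
      norm_cast
      field_simp
    rw [h2, Complex.ofReal_re, div_mul_eq_mul_div, div_le_iff₀ hm1] at h1
    exact h1
  have hl2 : ∀ x, √(l2Sq τ x) ≤ ‖x‖ := fun x => Real.sqrt_le_iff.2 ⟨norm_nonneg _, hτ.l2Sq_le x⟩
  -- The norm constraint could be active at `b₀`; the `L¹`-norm rules out its having any effect. Let
  -- `c` be an approximate projection of `y` onto `B`. On `B` the functional of `c` has norm at most
  -- about `β / r`, so testing the `L¹`-norm on `B` gives `|τ(c a*)| ≤ β` up to an error, although
  -- `a` need not be in `B`. Also `Re τ(c* b₀)` is about `β`. Subtracting, `‖c‖₂²`, which is about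
  -- `Re τ(c* (a - b₀))`, is nearly `0`.
  have key : ∀ ε > 0, ‖τ (star n * y)‖ ≤ √(l2Sq τ n) * (√(4 * r * ε + ε ^ 2) + ε) := by
    intro ε hε
    obtain ⟨c, hc, happ⟩ := hτ.exists_l2_approx B.toNonUnitalSubalgebra.toSubmodule y (pow_pos hε 2)
    have happ' : ∀ m ∈ B, ‖τ (star m * (y - c))‖ ≤ ε * √(l2Sq τ m) := fun m hm => by
      refine abs_le_of_sq_le_sq' ((happ m hm).trans ?_) (by positivity) |>.2
      rw [mul_pow, Real.sq_sqrt (hτ.l2Sq_nonneg m)]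
    have hsplit : ∀ m, τ (star m * y) = τ (star m * c) + τ (star m * (y - c)) := fun m => by
      rw [← map_add, ← mul_add, add_sub_cancel]
    have h1 : ‖τ (c * star a)‖ ≤ (β + r * ε) / r * ‖star a‖ := by
      refine hτ.norm_apply_mul_le B hc (by positivity) (fun m hm => ?_) _
      have h2 := hvar' (star m) (star_mem hm)
      have h3 := happ' (star m) (star_mem hm)
      rw [star_star, norm_star] at h2
      rw [star_star] at h3
      have h4 := hl2 (star m)
      rw [norm_star] at h4
      rw [hτ.trace, div_mul_eq_mul_div, le_div_iff₀ hr]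
      have h5 : τ (m * c) = τ (m * y) - τ (m * (y - c)) := by
        rw [← map_sub, ← mul_sub, sub_sub_cancel]
      have h6 : ‖τ (m * c)‖ ≤ ‖τ (m * y)‖ + ε * ‖m‖ :=
        h5 ▸ (norm_sub_le _ _).trans (add_le_add le_rfl (h3.trans (by gcongr)))
      nlinarith
    have h2 : ‖τ (c * star a)‖ ≤ β + r * ε := by
      rwa [norm_star, div_mul_cancel₀ _ hr.ne'] at h1
    set q := √(l2Sq τ c) with hq
    have hq2 : q ^ 2 = l2Sq τ c := Real.sq_sqrt (hτ.l2Sq_nonneg c)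
    have h3 : (τ (star c * a)).re ≤ β + r * ε := by
      have h4 : τ (star c * a) = star (τ (c * star a)) := by
        rw [← hτ.map_star, star_mul, star_star, hτ.trace]
      rw [h4]
      exact (Complex.re_le_norm _).trans (by rwa [norm_star])
    have h4 : β - ε * r ≤ (τ (star c * b₀)).re := by
      have h5 : τ (star c * b₀) = star (τ (star b₀ * c)) := by
        rw [← hτ.map_star, star_mul, star_star]
      have h6 := happ' b₀ hb₀
      have h7 : (τ (star b₀ * (y - c))).re ≤ ε * r :=
        (Complex.re_le_norm _).trans (h6.trans (by gcongr; exact (hl2 b₀).trans hn))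
      have h8 := congrArg Complex.re (hsplit b₀)
      rw [Complex.add_re] at h8
      rw [h5]
      simp only [Complex.star_def, Complex.conj_re]
      linarith
    have h5 : q ^ 2 ≤ 2 * r * ε + ε * q := by
      have h6 := congrArg Complex.re (hsplit c)
      have h7 : -(τ (star c * (y - c))).re ≤ ε * q :=
        (neg_le_abs _).trans ((Complex.abs_re_le_norm _).trans (happ' c hc))
      have h8 : (τ (star c * y)).re = (τ (star c * a)).re - (τ (star c * b₀)).re := by
        rw [hy, mul_sub, map_sub, Complex.sub_re]
      rw [Complex.add_re] at h6
      have h9 : (τ (star c * c)).re = q ^ 2 := hq2.symm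
      linarith
    have h6 : q ≤ √(4 * r * ε + ε ^ 2) := by
      apply Real.le_sqrt_of_sq_le
      nlinarith [sq_nonneg (q - ε)]
    have h7 : ‖τ (star n * c)‖ ≤ √(l2Sq τ n) * q := by
      refine abs_le_of_sq_le_sq' ((hτ.cauchy_schwarz n c).trans (le_of_eq ?_)) (by positivity) |>.2
      rw [mul_pow, hq2, Real.sq_sqrt (hτ.l2Sq_nonneg n)]
    calc ‖τ (star n * y)‖ ≤ ‖τ (star n * c)‖ + ‖τ (star n * (y - c))‖ := hsplit n ▸ norm_add_le _ _
      _ ≤ √(l2Sq τ n) * q + ε * √(l2Sq τ n) := add_le_add h7 (happ' n hnB)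
      _ = √(l2Sq τ n) * (q + ε) := by ring
      _ ≤ _ := by gcongr
  have hlim : Filter.Tendsto (fun ε : ℝ => √(l2Sq τ n) * (√(4 * r * ε + ε ^ 2) + ε))
      (nhdsWithin 0 (Set.Ioi 0)) (nhds 0) := by
    have : Continuous fun ε : ℝ => √(l2Sq τ n) * (√(4 * r * ε + ε ^ 2) + ε) := by fun_prop
    have h := this.tendsto 0
    simp only [mul_zero, ne_eq, OfNat.ofNat_ne_zero, not_false_eq_true, zero_pow, add_zero,
      Real.sqrt_zero] at h
    exact h.mono_left nhdsWithin_le_nhds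
  rw [← norm_le_zero_iff]
  exact ge_of_tendsto hlim (Filter.eventually_of_mem self_mem_nhdsWithin key)

end IsTraceState

end CondExp

/-! ### Von Neumann algebras -/

section VonNeumann

variable {H : Type*} [NormedAddCommGroup H] [InnerProductSpace ℂ H] [CompleteSpace H]

/-- A double commutant is a centralizer, hence closed. -/
theorem isClosed_vonNeumann (M : VonNeumannAlgebra H) :
    IsClosed (M.toStarSubalgebra : Set (H →L[ℂ] H)) := by
  have h : (M.toStarSubalgebra : Set (H →L[ℂ] H)) =
      Set.centralizer (Set.centralizer (M : Set (H →L[ℂ] H))) := M.centralizer_centralizer.symm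
  rw [h]
  exact Set.isClosed_centralizer _

instance completeSpace_vonNeumann (M : VonNeumannAlgebra H) : CompleteSpace M.toStarSubalgebra :=
  (isClosed_vonNeumann M).completeSpace_coe

theorem IsFaithfulNormalTraceState.isTraceState {M : VonNeumannAlgebra H}
    {τ : StrongDual ℂ M.toStarSubalgebra} (hτ : IsFaithfulNormalTraceState M τ) :
    IsTraceState τ := ⟨hτ.map_one, hτ.nonneg, hτ.trace⟩

/-- The embedding of `M` into the bounded operators with the weak operator topology. -/
def toWOT (M : VonNeumannAlgebra H) (x : M.toStarSubalgebra) : H →WOT[ℂ] H :=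
  ContinuousLinearMapWOT.ofCLM (x : H →L[ℂ] H)

variable {M : VonNeumannAlgebra H}

theorem mem_wStar_iff {A : Set M.toStarSubalgebra} {x : M.toStarSubalgebra} :
    x ∈ wStar M A ↔ toWOT M x ∈ closure (toWOT M '' A) := Iff.rfl

theorem subset_wStar (A : Set M.toStarSubalgebra) : A ⊆ wStar M A := fun _ hx =>
  subset_closure ⟨_, hx, rfl⟩

/-- Maps which are continuous for the weak operator topology preserve weak closures. -/
theorem map_mem_wStar {A A' : Set M.toStarSubalgebra}
    {f : M.toStarSubalgebra → M.toStarSubalgebra} {F : (H →WOT[ℂ] H) → (H →WOT[ℂ] H)}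
    (hF : Continuous F) (hfF : ∀ x, F (toWOT M x) = toWOT M (f x))
    (hf : ∀ a ∈ A, f a ∈ wStar M A') {x : M.toStarSubalgebra} (hx : x ∈ wStar M A) :
    f x ∈ wStar M A' := by
  have h : closure (toWOT M '' A) ⊆ F ⁻¹' closure (toWOT M '' A') := by
    refine closure_minimal ?_ (isClosed_closure.preimage hF)
    rintro _ ⟨a, ha, rfl⟩
    rw [Set.mem_preimage, hfF]
    exact hf a ha
  have h1 := h (mem_wStar_iff.1 hx)
  rwa [Set.mem_preimage, hfF] at h1

theorem continuous_wot_mul_left (T : H →L[ℂ] H) :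
    Continuous fun A : H →WOT[ℂ] H => ContinuousLinearMapWOT.ofCLM T * A :=
  ContinuousLinearMapWOT.continuous_postcomp _

theorem continuous_wot_mul_right (T : H →L[ℂ] H) :
    Continuous fun A : H →WOT[ℂ] H => A * ContinuousLinearMapWOT.ofCLM T :=
  ContinuousLinearMapWOT.continuous_precomp _

/-- The von Neumann algebra generated by a `*`-subalgebra. -/
def wStarAlg (M : VonNeumannAlgebra H) (P : NonUnitalStarSubalgebra ℂ M.toStarSubalgebra) :
    NonUnitalStarSubalgebra ℂ M.toStarSubalgebra where
  carrier := wStar M P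
  zero_mem' := subset_wStar _ (zero_mem P)
  add_mem' := by
    intro x y hx hy
    refine map_mem_wStar (f := fun x => x + y) (F := fun A => A + toWOT M y)
      (by fun_prop) (fun _ => rfl) (fun a ha => ?_) hx
    exact map_mem_wStar (f := fun y => a + y) (F := fun A => toWOT M a + A)
      (by fun_prop) (fun _ => rfl) (fun b hb => subset_wStar _ (add_mem ha hb)) hy
  -- Multiplication is only separately continuous in the weak operator topology, so limits are taken
  -- in one factor at a time.
  mul_mem' := by
    intro x y hx hy
    refine map_mem_wStar (f := fun x => x * y) (continuous_wot_mul_right (y : H →L[ℂ] H))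
      (fun _ => rfl) (fun a ha => ?_) hx
    exact map_mem_wStar (f := fun y => a * y) (continuous_wot_mul_left (a : H →L[ℂ] H))
      (fun _ => rfl) (fun b hb => subset_wStar _ (mul_mem ha hb)) hy
  smul_mem' := by
    intro c x hx
    exact map_mem_wStar (f := fun x => c • x) (F := fun A => c • A) (by fun_prop)
      (fun _ => rfl) (fun b hb => subset_wStar _ (SMulMemClass.smul_mem c hb)) hx
  star_mem' := by
    intro x hx
    exact map_mem_wStar (f := fun x => star x) (F := fun A => star A) (by fun_prop)
      (fun _ => rfl) (fun b hb => subset_wStar _ (star_mem (S := NonUnitalStarSubalgebra ℂ _) hb)) hx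

/-- A weakly closed condition of the form `S x T = x` passes to the generated algebra. -/
theorem mul_mul_eq_of_mem_wStar {A : Set M.toStarSubalgebra} {s t : M.toStarSubalgebra}
    (h : ∀ a ∈ A, s * a * t = a) {x : M.toStarSubalgebra} (hx : x ∈ wStar M A) : s * x * t = x := by
  have hcont : Continuous fun A : H →WOT[ℂ] H => toWOT M s * A * toWOT M t :=
    (continuous_wot_mul_right (t : H →L[ℂ] H)).comp (continuous_wot_mul_left (s : H →L[ℂ] H))
  have hcl : IsClosed {A : H →WOT[ℂ] H | toWOT M s * A * toWOT M t = A} :=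
    isClosed_eq hcont continuous_id
  have h2 : closure (toWOT M '' A) ⊆ _ := closure_minimal (by
    rintro _ ⟨a, ha, rfl⟩
    exact congrArg (toWOT M) (h a ha)) hcl
  have h3 := h2 hx
  exact Subtype.ext (ContinuousLinearMapWOT.ofCLM_injective h3)

theorem commute_of_mem_wStar {A : Set M.toStarSubalgebra} {T : H →L[ℂ] H}
    (h : ∀ a ∈ A, (a : H →L[ℂ] H) * T = T * a) {x : M.toStarSubalgebra} (hx : x ∈ wStar M A) :
    (x : H →L[ℂ] H) * T = T * x := by
  have hcl : IsClosed {A : H →WOT[ℂ] H | A * ContinuousLinearMapWOT.ofCLM T =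
      ContinuousLinearMapWOT.ofCLM T * A} :=
    isClosed_eq (continuous_wot_mul_right T) (continuous_wot_mul_left T)
  have h2 : closure (toWOT M '' A) ⊆ _ := closure_minimal (by
    rintro _ ⟨a, ha, rfl⟩
    exact congrArg ContinuousLinearMapWOT.ofCLM (h a ha)) hcl
  exact ContinuousLinearMapWOT.ofCLM_injective (h2 hx)

end VonNeumann

/-! ### Density through amplification to `ℓ²(ℕ, H)` -/

section Density

variable {H : Type*} [NormedAddCommGroup H] [InnerProductSpace ℂ H] [CompleteSpace H]

theorem memlp_two_of_summable {v : ℕ → H} (hv : Summable fun i => ‖v i‖ ^ 2) : Memℓp v 2 := by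
  refine memℓp_gen ?_
  simpa using hv

theorem memlp_map (T : H →L[ℂ] H) (v : lp (fun _ : ℕ => H) 2) :
    Memℓp (fun i => T (v i)) 2 := by
  have h := lp.memℓp v
  refine memlp_two_of_summable ?_
  have h1 : Summable fun i => ‖v i‖ ^ 2 := by
    have := (memℓp_gen_iff (by norm_num)).1 h
    simpa using this
  refine Summable.of_nonneg_of_le (fun i => by positivity) (fun i => ?_) (h1.mul_left (‖T‖ ^ 2))
  rw [← mul_pow]
  gcongr
  exact T.le_opNorm _

/-- The amplification `T ⊗ 1` on `ℓ²(ℕ, H)`. -/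
def amplify (T : H →L[ℂ] H) : lp (fun _ : ℕ => H) 2 →L[ℂ] lp (fun _ : ℕ => H) 2 :=
  LinearMap.mkContinuous
    { toFun := fun v => ⟨fun i => T (v i), memlp_map T v⟩
      map_add' := fun v w => by ext i; exact T.map_add _ _
      map_smul' := fun c v => by ext i; exact T.map_smul _ _ } ‖T‖ fun v => by
    have h2 : (0 : ℝ) < (2 : ENNReal).toReal := by norm_num
    refine lp.norm_le_of_forall_sum_le h2 (by positivity) fun s => ?_
    calc ∑ i ∈ s, ‖T (v i)‖ ^ (2 : ENNReal).toReal
        ≤ ∑ i ∈ s, ‖T‖ ^ (2 : ENNReal).toReal * ‖v i‖ ^ (2 : ENNReal).toReal := by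
          refine Finset.sum_le_sum fun i _ => ?_
          rw [← Real.mul_rpow (norm_nonneg _) (norm_nonneg _)]
          exact Real.rpow_le_rpow (norm_nonneg _) (T.le_opNorm _) h2.le
      _ ≤ ‖T‖ ^ (2 : ENNReal).toReal * ‖v‖ ^ (2 : ENNReal).toReal := by
          rw [← Finset.mul_sum]
          gcongr
          exact lp.sum_rpow_le_norm_rpow h2 v s
      _ = (‖T‖ * ‖v‖) ^ (2 : ENNReal).toReal := (Real.mul_rpow (norm_nonneg _) (norm_nonneg _)).symm

@[simp] theorem amplify_apply (T : H →L[ℂ] H) (v : lp (fun _ : ℕ => H) 2) (i : ℕ) :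
    amplify T v i = T (v i) := rfl

theorem norm_amplify_apply_le (T : H →L[ℂ] H) (v : lp (fun _ : ℕ => H) 2) :
    ‖amplify T v‖ ≤ ‖T‖ * ‖v‖ :=
  (amplify T).le_of_opNorm_le (LinearMap.mkContinuous_norm_le _ (norm_nonneg _) _) v

theorem inner_amplify_star (T : H →L[ℂ] H) (v w : lp (fun _ : ℕ => H) 2) :
    inner ℂ (amplify (star T) v) w = inner ℂ v (amplify T w) := by
  rw [lp.inner_eq_tsum, lp.inner_eq_tsum]
  congr 1
  ext i
  rw [amplify_apply, amplify_apply, ContinuousLinearMap.star_eq_adjoint,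
    ContinuousLinearMap.adjoint_inner_left]

theorem amplify_single (T : H →L[ℂ] H) (i : ℕ) (h : H) :
    amplify T (lp.single 2 i h) = lp.single 2 i (T h) := by
  ext j
  rw [amplify_apply]
  rcases eq_or_ne j i with rfl | hij
  · simp
  · simp [hij]

variable {M : VonNeumannAlgebra H}

/-- Elements of the von Neumann algebra generated by a `*`-algebra `P` commute with the commutant
of `P` even after amplification. -/
theorem amplify_commute_of_mem_wStar {A : Set M.toStarSubalgebra}
    {Q : lp (fun _ : ℕ => H) 2 →L[ℂ] lp (fun _ : ℕ => H) 2}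
    (hQ : ∀ a ∈ A, ∀ v, Q (amplify (a : H →L[ℂ] H) v) = amplify (a : H →L[ℂ] H) (Q v))
    {x : M.toStarSubalgebra} (hx : x ∈ wStar M A) (v : lp (fun _ : ℕ => H) 2) :
    Q (amplify (x : H →L[ℂ] H) v) = amplify (x : H →L[ℂ] H) (Q v) := by
  -- The matrix entries of `Q` are operators on `H` commuting with `A`, hence with `x`; only weak
  -- closure on `H` itself is used.
  have hentry : ∀ i j (h : H), Q (lp.single 2 j ((x : H →L[ℂ] H) h)) i =
      (x : H →L[ℂ] H) (Q (lp.single 2 j h) i) := by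
    intro i j h
    let T : H →L[ℂ] H := lp.evalCLM ℂ (fun _ : ℕ => H) 2 i ∘L Q ∘L
      lp.singleContinuousLinearMap ℂ (fun _ : ℕ => H) 2 j
    have hT : ∀ h, T h = Q (lp.single 2 j h) i := fun h => rfl
    have h1 := commute_of_mem_wStar (T := T) (fun a ha => ContinuousLinearMap.ext fun h => by
      have h2 := hQ a ha (lp.single 2 j h)
      rw [amplify_single] at h2
      have h3 := congrArg (fun w : lp (fun _ : ℕ => H) 2 => w i) h2
      exact h3.symm) hx
    have h2 := congrArg (fun S : H →L[ℂ] H => S h) h1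
    exact h2.symm
  have hs := lp.hasSum_single (p := 2) (by norm_num) v
  have h1 : HasSum (fun j => Q (amplify (x : H →L[ℂ] H) (lp.single 2 j (v j))))
      (Q (amplify (x : H →L[ℂ] H) v)) :=
    (hs.mapL (amplify (x : H →L[ℂ] H))).mapL Q
  have h2 : HasSum (fun j => amplify (x : H →L[ℂ] H) (Q (lp.single 2 j (v j))))
      (amplify (x : H →L[ℂ] H) (Q v)) :=
    (hs.mapL Q).mapL (amplify (x : H →L[ℂ] H))
  refine h1.unique ?_
  convert h2 using 2 with j
  ext i
  rw [amplify_single, hentry, amplify_apply]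

/-- The density theorem, in the form: a `*`-algebra with unit `e` is `σ`-strongly dense in the
von Neumann algebra it generates. -/
theorem exists_amplify_approx (P : NonUnitalStarSubalgebra ℂ M.toStarSubalgebra)
    {e : M.toStarSubalgebra} (he : e ∈ P) (hle : ∀ a ∈ P, e * a = a) (hre : ∀ a ∈ P, a * e = a)
    {x : M.toStarSubalgebra} (hx : x ∈ wStar M (P : Set M.toStarSubalgebra))
    (v : lp (fun _ : ℕ => H) 2) {ε : ℝ} (hε : 0 < ε) :
    ∃ a ∈ P, ‖amplify ((x - a : M.toStarSubalgebra) : H →L[ℂ] H) v‖ < ε := by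
  let f : M.toStarSubalgebra →ₗ[ℂ] lp (fun _ : ℕ => H) 2 :=
    { toFun := fun a => amplify (a : H →L[ℂ] H) v
      map_add' := fun a b => by ext i; simp
      map_smul' := fun c a => by ext i; simp }
  let V : Submodule ℂ (lp (fun _ : ℕ => H) 2) :=
    (P.toNonUnitalSubalgebra.toSubmodule.map f).topologicalClosure
  have hV : IsClosed (V : Set (lp (fun _ : ℕ => H) 2)) := Submodule.isClosed_topologicalClosure _
  have : CompleteSpace V := hV.completeSpace_coe
  have hfV : ∀ a ∈ P, f a ∈ V := fun a ha =>
    Submodule.le_topologicalClosure _ (Submodule.mem_map_of_mem ha)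
  have hinv : ∀ a ∈ P, ∀ w ∈ V, amplify (a : H →L[ℂ] H) w ∈ V := by
    intro a ha w hw
    refine map_mem_closure (amplify (a : H →L[ℂ] H)).continuous hw ?_
    rintro _ ⟨b, hb, rfl⟩
    exact ⟨a * b, mul_mem (S := NonUnitalStarSubalgebra ℂ M.toStarSubalgebra) ha hb, rfl⟩
  -- `V` is invariant under the `*`-closed `P`, so its projection commutes with `P`, and therefore
  -- with `x`. Applied to `f e ∈ V` this puts `f x = x (f e)` in `V`.
  have hcomm : ∀ a ∈ P, ∀ w, V.starProjection (amplify (a : H →L[ℂ] H) w) =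
      amplify (a : H →L[ℂ] H) (V.starProjection w) := by
    intro a ha w
    refine (Submodule.eq_starProjection_of_mem_of_inner_eq_zero
      (hinv a ha _ (Submodule.starProjection_apply_mem _ _)) fun z hz => ?_)
    have h1 := Submodule.starProjection_inner_eq_zero (K := V) w _ (hinv (star a) (star_mem ha) z hz)
    rw [← map_sub]
    rw [← inner_conj_symm] at h1 ⊢
    rw [← inner_amplify_star]
    exact h1
  have h1 := amplify_commute_of_mem_wStar hcomm hx (f e)
  have h2 : V.starProjection (f e) = f e :=
    Submodule.starProjection_eq_self_iff.2 (hfV e he)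
  have hex : x * e = x := by
    have := mul_mul_eq_of_mem_wStar (s := e) (t := e) (fun a ha => by
      rw [hle a ha, hre a ha]) hx
    calc x * e = e * x * e * e := by rw [this]
      _ = x := by rw [mul_assoc _ e e, hre e he, this]
  have h3 : amplify (x : H →L[ℂ] H) (f e) = f x := by
    conv_rhs => rw [← hex]
    rfl
  rw [h2, h3] at h1
  have h4 : f x ∈ V := h1 ▸ Submodule.starProjection_apply_mem _ _
  obtain ⟨_, ⟨a, ha, rfl⟩, h5⟩ := Metric.mem_closure_iff.1 h4 ε hε
  refine ⟨a, ha, ?_⟩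
  rw [dist_eq_norm, ← map_sub] at h5
  exact h5

/-- A normal functional is a vector functional of the amplification. -/
theorem IsFaithfulNormalTraceState.exists_vector {τ : StrongDual ℂ M.toStarSubalgebra}
    (hτ : IsFaithfulNormalTraceState M τ) : ∃ v w : lp (fun _ : ℕ => H) 2,
      ∀ x : M.toStarSubalgebra, τ x = inner ℂ v (amplify (x : H →L[ℂ] H) w) := by
  obtain ⟨ξ, η, hξ, hη, h⟩ := hτ.normal
  refine ⟨⟨ξ, memlp_two_of_summable hξ⟩, ⟨η, memlp_two_of_summable hη⟩, fun x => ?_⟩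
  exact (h x).unique (lp.hasSum_inner _ _)

/-- After moving `x - a` to the right, `τ(y (x - a)) = ⟪v, y (x - a) w⟫` on the amplification.
Smallness of `(x - a) w` at the single vector `w` is thus uniform in `y`. -/
theorem exists_l1_approx {τ : StrongDual ℂ M.toStarSubalgebra}
    (hτ : IsFaithfulNormalTraceState M τ) (P : NonUnitalStarSubalgebra ℂ M.toStarSubalgebra)
    {e : M.toStarSubalgebra} (he : e ∈ P) (hle : ∀ a ∈ P, e * a = a) (hre : ∀ a ∈ P, a * e = a)
    {x : M.toStarSubalgebra} (hx : x ∈ wStar M (P : Set M.toStarSubalgebra)) {δ : ℝ} (hδ : 0 < δ) :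
    ∃ a ∈ P, ∀ y, ‖τ ((x - a) * y)‖ ≤ δ * ‖y‖ := by
  obtain ⟨v, w, hvw⟩ := hτ.exists_vector
  obtain ⟨a, ha, h⟩ := exists_amplify_approx P he hle hre hx w
    (ε := δ / (‖v‖ + 1)) (by positivity)
  refine ⟨a, ha, fun y => ?_⟩
  rw [hτ.trace, hvw]
  calc ‖inner ℂ v (amplify ((y * (x - a) : M.toStarSubalgebra) : H →L[ℂ] H) w)‖
      ≤ ‖v‖ * ‖amplify (y : H →L[ℂ] H) (amplify ((x - a : M.toStarSubalgebra) : H →L[ℂ] H) w)‖ :=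
        norm_inner_le_norm _ _
    _ ≤ ‖v‖ * (‖y‖ * (δ / (‖v‖ + 1))) := by
        gcongr
        exact (norm_amplify_apply_le _ _).trans (mul_le_mul_of_nonneg_left h.le (norm_nonneg _))
    _ = δ * ‖y‖ * (‖v‖ / (‖v‖ + 1)) := by ring
    _ ≤ δ * ‖y‖ := by
        refine mul_le_of_le_one_right (by positivity) ?_
        rw [div_le_one (by positivity)]
        linarith

theorem L1_wStar_subset {τ : StrongDual ℂ M.toStarSubalgebra}
    (hτ : IsFaithfulNormalTraceState M τ) (P : NonUnitalStarSubalgebra ℂ M.toStarSubalgebra)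
    {e : M.toStarSubalgebra} (he : e ∈ P) (hle : ∀ a ∈ P, e * a = a) (hre : ∀ a ∈ P, a * e = a)
    (c : M.toStarSubalgebra) :
    L1 τ c (wStar M (P : Set M.toStarSubalgebra)) ⊆ L1 τ c (P : Set M.toStarSubalgebra) := by
  refine closure_minimal ?_ isClosed_closure
  rintro _ ⟨x, hx, rfl⟩
  refine mem_closure_dual_iff.2 fun δ hδ => ?_
  obtain ⟨a, ha, h⟩ := exists_l1_approx hτ P he hle hre hx (δ := δ / (‖(τ c)⁻¹‖ + 1))
    (by positivity)
  refine ⟨_, ⟨a, ha, rfl⟩, fun y => ?_⟩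
  rw [toL1_apply, toL1_apply, ← mul_sub, ← map_sub, ← sub_mul, norm_mul]
  calc ‖(τ c)⁻¹‖ * ‖τ ((x - a) * y)‖
      ≤ (‖(τ c)⁻¹‖ + 1) * (δ / (‖(τ c)⁻¹‖ + 1) * ‖(y : M.toStarSubalgebra)‖) := by
        gcongr
        · linarith
        · exact h y
    _ = δ * ‖y‖ := by rw [Submodule.coe_norm]; field_simp

end Density

/-! ### Existence of `E_B` by weak compactness of balls -/

section CondExpExistence

variable {H : Type*} [NormedAddCommGroup H] [InnerProductSpace ℂ H] [CompleteSpace H]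

theorem exists_ultrafilter_lim (U : Ultrafilter ℕ) {f : ℕ → ℂ} {C : ℝ} (hf : ∀ k, ‖f k‖ ≤ C) :
    ∃ z, ‖z‖ ≤ C ∧ Filter.Tendsto f U (nhds z) := by
  obtain ⟨z, hz, h⟩ := (isCompact_closedBall (0 : ℂ) C).ultrafilter_le_nhds (U.map f) (by
    rw [Filter.le_principal_iff, Ultrafilter.coe_map, Filter.mem_map]
    exact Filter.Eventually.of_forall fun k => by simpa using hf k)
  exact ⟨z, by simpa using hz, h⟩

/-- Balls of bounded operators are compact in the weak operator topology. -/
theorem exists_wot_ultrafilter_lim (U : Ultrafilter ℕ) {b : ℕ → H →L[ℂ] H} {r : ℝ}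
    (hb : ∀ k, ‖b k‖ ≤ r) :
    ∃ T : H →L[ℂ] H, ‖T‖ ≤ r ∧
      ∀ v w, Filter.Tendsto (fun k => inner ℂ v (b k w)) U (nhds (inner ℂ v (T w))) := by
  have hr : 0 ≤ r := (norm_nonneg _).trans (hb 0)
  have hbd : ∀ v w k, ‖inner ℂ v (b k w)‖ ≤ r * ‖v‖ * ‖w‖ := fun v w k => by
    calc ‖inner ℂ v (b k w)‖ ≤ ‖v‖ * ‖b k w‖ := norm_inner_le_norm _ _
      _ ≤ ‖v‖ * (r * ‖w‖) := by gcongr; exact (b k).le_of_opNorm_le (hb k) w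
      _ = r * ‖v‖ * ‖w‖ := by ring
  choose c hc hlim using fun v w => exists_ultrafilter_lim U (hbd v w)
  -- The limits of the matrix coefficients form a bounded sesquilinear form, which is represented by
  -- an operator.
  let S : H →L⋆[ℂ] H →L[ℂ] ℂ := LinearMap.mkContinuous₂
    (LinearMap.mk₂'ₛₗ (starRingEnd ℂ) (RingHom.id ℂ) c
      (fun v v' w => tendsto_nhds_unique (hlim (v + v') w) (by
        simpa only [inner_add_left] using (hlim v w).add (hlim v' w)))
      (fun r v w => tendsto_nhds_unique (hlim (r • v) w) (by
        simpa only [inner_smul_left, smul_eq_mul] using (hlim v w).const_mul _))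
      (fun v w w' => tendsto_nhds_unique (hlim v (w + w')) (by
        simpa only [map_add, inner_add_right] using (hlim v w).add (hlim v w')))
      (fun r v w => tendsto_nhds_unique (hlim v (r • w)) (by
        simpa only [map_smul, inner_smul_right, smul_eq_mul, RingHom.id_apply] using (hlim v w).const_mul _))) r hc
  let T := ContinuousLinearMap.adjoint (InnerProductSpace.continuousLinearMapOfBilin S)
  have hT : ∀ v w, inner ℂ v (T w) = c v w := fun v w => by
    rw [ContinuousLinearMap.adjoint_inner_right, InnerProductSpace.continuousLinearMapOfBilin_apply]
    rfl
  refine ⟨T, ContinuousLinearMap.opNorm_le_bound _ hr fun w => ?_, fun v w => hT v w ▸ hlim v w⟩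
  have h1 := hc (T w) w
  rw [← hT, inner_self_eq_norm_sq_to_K, norm_pow, RCLike.norm_ofReal, abs_norm, sq] at h1
  rcases (norm_nonneg (T w)).eq_or_lt with h0 | h0
  · rw [← h0]; positivity
  · exact le_of_mul_le_mul_left (by linarith) h0

variable {M : VonNeumannAlgebra H}

/-- Commutation with each element of the commutant passes to the weak limit, so the limit stays in
`M`. -/
theorem exists_mem_ultrafilter_lim (U : Ultrafilter ℕ) {b : ℕ → M.toStarSubalgebra} {r : ℝ}
    (hb : ∀ k, ‖b k‖ ≤ r) :
    ∃ T : M.toStarSubalgebra, ‖T‖ ≤ r ∧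
      Filter.Tendsto (fun k => toWOT M (b k)) U (nhds (toWOT M T)) := by
  obtain ⟨T, hTr, hT⟩ := exists_wot_ultrafilter_lim U (b := fun k => (b k : H →L[ℂ] H)) hb
  have hmem : T ∈ M.toStarSubalgebra := by
    change T ∈ (M : Set (H →L[ℂ] H))
    rw [← M.centralizer_centralizer, Set.mem_centralizer_iff]
    intro S hS
    refine ContinuousLinearMap.ext fun w => ext_inner_left ℂ fun v => ?_
    have h1 := hT (ContinuousLinearMap.adjoint S v) w
    have h2 := hT v (S w)
    rw [ContinuousLinearMap.adjoint_inner_left] at h1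
    refine tendsto_nhds_unique h1 (h2.congr fun k => ?_)
    rw [ContinuousLinearMap.adjoint_inner_left]
    have h3 := Set.mem_centralizer_iff.1 hS (b k) (b k).2
    exact congrArg (inner ℂ v) (congrArg (fun A : H →L[ℂ] H => A w) h3)
  refine ⟨⟨T, hmem⟩, hTr, ?_⟩
  rw [ContinuousLinearMapWOT.tendsto_iff_forall_inner_apply_tendsto]
  exact fun w v => hT v w

/-- Normal functionals are weakly continuous along bounded sequences. -/
theorem IsFaithfulNormalTraceState.tendsto_apply_mul {τ : StrongDual ℂ M.toStarSubalgebra}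
    (hτ : IsFaithfulNormalTraceState M τ) {l : Filter ℕ} {b : ℕ → M.toStarSubalgebra} {r : ℝ}
    (hb : ∀ k, ‖b k‖ ≤ r) {T : M.toStarSubalgebra}
    (hT : Filter.Tendsto (fun k => toWOT M (b k)) l (nhds (toWOT M T))) (y : M.toStarSubalgebra) :
    Filter.Tendsto (fun k => τ (y * b k)) l (nhds (τ (y * T))) := by
  obtain ⟨ξ, η, hξ, hη, h⟩ := hτ.normal
  have hr : 0 ≤ r := (norm_nonneg _).trans (hb 0)
  have h1 : ∀ x, τ x = ∑' i, inner ℂ (ξ i) ((x : H →L[ℂ] H) (η i)) := fun x => (h x).tsum_eq.symm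
  simp only [h1]
  refine tendsto_tsum_of_dominated_convergence
    (bound := fun i => ‖y‖ * r * (‖ξ i‖ ^ 2 + ‖η i‖ ^ 2)) ((hξ.add hη).mul_left _)
    (fun i => ?_) (Filter.Eventually.of_forall fun k i => ?_)
  · have h2 := ContinuousLinearMapWOT.tendsto_iff_forall_inner_apply_tendsto.1 hT (η i)
      (ContinuousLinearMap.adjoint (y : H →L[ℂ] H) (ξ i))
    simp only [ContinuousLinearMap.adjoint_inner_left] at h2
    exact h2
  · have h2 : ‖((y * b k : M.toStarSubalgebra) : H →L[ℂ] H) (η i)‖ ≤ ‖y‖ * r * ‖η i‖ :=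
      (((y * b k : M.toStarSubalgebra) : H →L[ℂ] H).le_opNorm _).trans (by
        gcongr
        exact (norm_mul_le y (b k)).trans (by gcongr; exact hb k))
    calc _ ≤ ‖ξ i‖ * ‖((y * b k : M.toStarSubalgebra) : H →L[ℂ] H) (η i)‖ :=
          norm_inner_le_norm _ _
      _ ≤ ‖ξ i‖ * (‖y‖ * r * ‖η i‖) := by gcongr
      _ = ‖y‖ * r * (‖ξ i‖ * ‖η i‖) := by ring
      _ ≤ _ := by
        gcongr
        nlinarith [sq_nonneg (‖ξ i‖ - ‖η i‖), sq_nonneg ‖ξ i‖, sq_nonneg ‖η i‖]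

/-- The trace preserving conditional expectation onto a von Neumann subalgebra exists. -/
theorem exists_isCondExp {τ : StrongDual ℂ M.toStarSubalgebra}
    (hτ : IsFaithfulNormalTraceState M τ) (B : NonUnitalStarSubalgebra ℂ M.toStarSubalgebra)
    (hB : wStar M (B : Set M.toStarSubalgebra) ⊆ B) (a : M.toStarSubalgebra) :
    ∃ c, IsCondExp τ (B : Set M.toStarSubalgebra) a c := by
  have hτ' := hτ.isTraceState
  let K : Set M.toStarSubalgebra := {b | b ∈ B ∧ ‖b‖ ≤ ‖a‖}
  let S := (fun b => l2Sq τ (a - b)) '' K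
  have hbdd : BddBelow S := ⟨0, by rintro _ ⟨b, _, rfl⟩; exact hτ'.l2Sq_nonneg _⟩
  have hne : S.Nonempty := ⟨_, 0, ⟨zero_mem B, by simp⟩, rfl⟩
  obtain ⟨u, -, hu, huS⟩ := exists_seq_tendsto_sInf hne hbdd
  choose b hbK hbu using huS
  let U : Ultrafilter ℕ := Ultrafilter.of Filter.atTop
  obtain ⟨T, hTr, hT⟩ := exists_mem_ultrafilter_lim U fun k => (hbK k).2
  have hTB : T ∈ B := hB (mem_closure_of_tendsto hT (Filter.Eventually.of_forall fun k =>
    ⟨b k, (hbK k).1, rfl⟩))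
  have hu' : Filter.Tendsto u U (nhds (sInf S)) := hu.mono_left (Ultrafilter.of_le _)
  -- Weak lower semicontinuity: Cauchy–Schwarz against `a - T` along the minimizing sequence bounds
  -- the square of `l2Sq τ (a - T)` by its product with the infimum.
  have hmin : l2Sq τ (a - T) ≤ sInf S := by
    have h1 : Filter.Tendsto (fun k => τ (star (a - T) * (a - b k))) U
        (nhds (τ (star (a - T) * (a - T)))) := by
      simp only [mul_sub (star (a - T)) a, map_sub]
      exact (hτ.tendsto_apply_mul (fun k => (hbK k).2) hT _).const_sub _
    have h2 : ‖τ (star (a - T) * (a - T))‖ ^ 2 ≤ l2Sq τ (a - T) * sInf S := by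
      refine le_of_tendsto_of_tendsto (h1.norm.pow 2) (hu'.const_mul _)
        (Filter.Eventually.of_forall fun k => ?_)
      dsimp only
      rw [← hbu k]
      exact hτ'.cauchy_schwarz _ _
    rw [hτ'.apply_star_mul_self, Complex.norm_real, Real.norm_of_nonneg (hτ'.l2Sq_nonneg _), sq]
      at h2
    rcases (hτ'.l2Sq_nonneg (a - T)).eq_or_lt with h0 | h0
    · rw [← h0]
      exact le_csInf hne (by rintro _ ⟨b, _, rfl⟩; exact hτ'.l2Sq_nonneg _)
    · exact le_of_mul_le_mul_left h2 h0
  refine ⟨T, hTB, fun n hn => ?_⟩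
  have h1 := hτ'.apply_star_mul_eq_zero_of_isMin B hTB hTr
    (fun b hb hbr => hmin.trans (csInf_le hbdd ⟨b, ⟨hb, hbr⟩, rfl⟩))
    (n := star n) (star_mem (S := NonUnitalStarSubalgebra ℂ M.toStarSubalgebra) hn)
  rw [star_star, hτ'.trace, sub_mul, map_sub, sub_eq_zero] at h1
  exact h1.symm

end CondExpExistence

/-! ### Reduced words and freeness with amalgamation -/

section Reduced

variable {R : Type*} [NormedRing R] [NormedAlgebra ℂ R]

theorem mem_polyAlg_iff {B : Subalgebra ℂ R} {X x : R} :
    x ∈ polyAlg (Subalgebra.toSubmodule B) X ↔ x ∈ Algebra.adjoin ℂ ((B : Set R) ∪ {X}) := by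
  constructor
  · intro hx
    have h : polyAlg (Subalgebra.toSubmodule B) X ≤
        (Algebra.adjoin ℂ ((B : Set R) ∪ {X})).toNonUnitalSubalgebra :=
      NonUnitalAlgebra.adjoin_le Algebra.subset_adjoin
    exact h hx
  · intro hx
    induction hx using Algebra.adjoin_induction with
    | mem x hx => exact NonUnitalAlgebra.subset_adjoin ℂ hx
    | algebraMap r => exact coeff_mem_polyAlg (B.algebraMap_mem r)
    | add x y _ _ hx hy => exact add_mem hx hy
    | mul x y _ _ hx hy => exact mul_mem hx hy

theorem isCondExp_zero_iff {τ : StrongDual ℂ R} {B : Subalgebra ℂ R} {a : R} :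
    IsCondExp τ (B : Set R) a 0 ↔ ∀ b ∈ B, τ (a * b) = 0 := by
  constructor
  · intro h b hb
    rw [← h.2 b hb, zero_mul, map_zero]
  · intro h
    exact ⟨B.zero_mem, fun b hb => by rw [h b hb, zero_mul, map_zero]⟩

/-- Words `u q w₁ q w₂ q ⋯ q v` with first letter `u`, where `u, v ∈ A` and the interior letters
`wᵢ ∈ A` are centred over `B`. -/
inductive ReducedWord (τ : StrongDual ℂ R) (B : Set R) (A : Subalgebra ℂ R) (q : R) : R → R → Prop
  | base {u v : R} : u ∈ A → v ∈ A → ReducedWord τ B A q u (u * q * v)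
  | step {u w m : R} : u ∈ A → w ∈ A → IsCondExp τ B w 0 → ReducedWord τ B A q w m →
      ReducedWord τ B A q u (u * q * m)

namespace ReducedWord

variable {τ : StrongDual ℂ R} {B : Set R} {A : Subalgebra ℂ R} {q u m : R}

theorem mul_left (h : ReducedWord τ B A q u m) {x : R} (hx : x ∈ A) :
    ReducedWord τ B A q (x * u) (x * m) := by
  cases h with
  | base hu hv =>
    rw [← mul_assoc, ← mul_assoc]
    exact base (A.mul_mem hx hu) hv
  | step hu hw hwc hm =>
    rw [← mul_assoc, ← mul_assoc]
    exact step (A.mul_mem hx hu) hw hwc hm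

/-- Stripping the uncentred outer letters leaves `q w₁ q ⋯ q`, an alternating centred word to which
freeness applies. -/
theorem exists_list {A₂ : Subalgebra ℂ R} (hq : q ∈ A₂) (hqc : IsCondExp τ B q 0)
    (h : ReducedWord τ B A q u m) : u ∈ A ∧ ∃ v ∈ A, ∃ l : List (Bool × R),
      ((false, q) :: l).IsChain (fun x y => x.1 ≠ y.1) ∧
      (∀ x ∈ (false, q) :: l, x.2 ∈ (if x.1 then A else A₂) ∧ IsCondExp τ B x.2 0) ∧
      m = u * (((false, q) :: l).map Prod.snd).prod * v := by
  induction h with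
  | @base u v hu hv => exact ⟨hu, v, hv, [], by simp, by simp [hq, hqc], by simp⟩
  | @step u w m hu hw hwc hm ih =>
    obtain ⟨-, v, hv, l, hl, hl2, rfl⟩ := ih
    refine ⟨hu, v, hv, (true, w) :: (false, q) :: l, ?_, ?_, ?_⟩
    · rw [List.isChain_cons_cons, List.isChain_cons_cons]
      exact ⟨by simp, by simp, hl⟩
    · intro x hx
      rcases List.mem_cons.1 hx with rfl | hx
      · exact ⟨by simpa using hq, hqc⟩
      rcases List.mem_cons.1 hx with rfl | hx
      · exact ⟨by simpa using hw, hwc⟩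
      · exact hl2 x hx
    · simp only [List.map_cons, List.prod_cons, mul_assoc]

end ReducedWord

variable {τ : StrongDual ℂ R} {B : Subalgebra ℂ R} {A A₂ : Subalgebra ℂ R} {q : R}

/-- Rotate `τ(u L v)` to `τ(v u L)` and split `v u` into its expectation and its centred part. The
centred part extends `L` to a longer alternating centred word; the expectation lies in `B`, where
`E_B(L) = 0` suffices. -/
theorem ReducedWord.apply_eq_zero (htr : ∀ x y, τ (x * y) = τ (y * x))
    (hE : ∀ a, ∃ c, IsCondExp τ (B : Set R) a c) (hBA : B ≤ A)
    (hfree : FreeOver τ (B : Set R) A A₂) (hq : q ∈ A₂) (hqc : IsCondExp τ (B : Set R) q 0)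
    {u m : R} (h : ReducedWord τ B A q u m) : τ m = 0 := by
  obtain ⟨hu, v, hv, l, hl, hl2, rfl⟩ := h.exists_list hq hqc
  set L := (((false, q) :: l).map Prod.snd).prod with hL
  obtain ⟨c, hcB, hc⟩ := hE (v * u)
  have h1 : τ (L * c) = 0 :=
    isCondExp_zero_iff.1 (hfree _ (List.cons_ne_nil _ _) hl hl2) c hcB
  have hcen : IsCondExp τ (B : Set R) (v * u - c) 0 := isCondExp_zero_iff.2 fun b hb => by
    rw [sub_mul, map_sub, hc b hb, sub_self]
  have h2 : τ ((v * u - c) * L) = 0 := by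
    have := hfree ((true, v * u - c) :: (false, q) :: l) (List.cons_ne_nil _ _)
      (List.isChain_cons_cons.2 ⟨by simp, hl⟩) (by
        intro x hx
        rcases List.mem_cons.1 hx with rfl | hx
        · exact ⟨by simpa using A.sub_mem (A.mul_mem hv hu) (hBA hcB), hcen⟩
        · exact hl2 x hx)
    have h3 := isCondExp_zero_iff.1 this 1 B.one_mem
    rwa [mul_one, List.map_cons, List.prod_cons] at h3
  rw [htr, ← mul_assoc, ← sub_add_cancel (v * u) c, add_mul, map_add, h2, htr c, h1, add_zero]

/-- The span of `A` and the reduced words. -/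
def reducedSpan (τ : StrongDual ℂ R) (B : Set R) (A : Subalgebra ℂ R) (q : R) : Submodule ℂ R :=
  Submodule.span ℂ ((A : Set R) ∪ {m | ∃ u, ReducedWord τ B A q u m})

theorem mul_mem_reducedSpan {x y : R} (hx : x ∈ A) (hy : y ∈ reducedSpan τ B A q) :
    x * y ∈ reducedSpan τ B A q := by
  have h : reducedSpan τ B A q ≤ (reducedSpan τ B A q).comap (LinearMap.mulLeft ℂ x) := by
    refine Submodule.span_le.2 ?_
    rintro m (hm | ⟨u, hm⟩)
    · exact Submodule.subset_span (Or.inl (A.mul_mem hx hm))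
    · exact Submodule.subset_span (Or.inr ⟨_, hm.mul_left hx⟩)
  exact h hy

/-- Prepending `q` turns the first letter `u` into an interior one. Its centred part gives a longer
reduced word; its expectation commutes with `q`, and the quadratic relation collapses `q q` without
creating an uncentred interior letter. -/
theorem var_mul_mem_reducedSpan (hE : ∀ a, ∃ c, IsCondExp τ (B : Set R) a c) (hBA : B ≤ A)
    (hqB : ∀ b ∈ B, q * b = b * q) {β γ : ℂ} (hq2 : q * q = β • q + γ • 1)
    {y : R} (hy : y ∈ reducedSpan τ B A q) : q * y ∈ reducedSpan τ B A q := by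
  have h : reducedSpan τ B A q ≤ (reducedSpan τ B A q).comap (LinearMap.mulLeft ℂ q) := by
    refine Submodule.span_le.2 ?_
    -- Here `r` is whatever follows the first `q`: a last letter in `A`, or a shorter reduced word
    -- with centred first letter.
    have key : ∀ u ∈ A, ∀ r, (∀ x ∈ A, x * r ∈ reducedSpan τ B A q) →
        (∀ x ∈ A, ReducedWord τ B A q x (x * q * r)) →
        q * (u * q * r) ∈ reducedSpan τ B A q := by
      intro u hu r h1 h2
      obtain ⟨c, hcB, hc⟩ := hE u
      have hcen : IsCondExp τ (B : Set R) (u - c) 0 := isCondExp_zero_iff.2 fun b hb => by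
        rw [sub_mul, map_sub, hc b hb, sub_self]
      have huc : u - c ∈ A := A.sub_mem hu (hBA hcB)
      have e1 : q * (u * q * r) = 1 * q * ((u - c) * q * r) + (β • (c * q * r) + γ • (c * r)) := by
        have e2 : q * (c * q * r) = β • (c * q * r) + γ • (c * r) := by
          calc q * (c * q * r) = c * (q * q) * r := by rw [← mul_assoc, ← mul_assoc, hqB c hcB,
                mul_assoc c q q]
            _ = _ := by
              rw [hq2]
              simp only [mul_add, add_mul, mul_smul_comm, smul_mul_assoc, mul_one]
        rw [← e2]
        noncomm_ring
      rw [e1]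
      refine Submodule.add_mem _ (Submodule.subset_span (Or.inr ⟨1, ?_⟩))
        (Submodule.add_mem _ (Submodule.smul_mem _ _ (Submodule.subset_span (Or.inr ⟨c, ?_⟩)))
          (Submodule.smul_mem _ _ ?_))
      · exact .step A.one_mem huc hcen (h2 _ huc)
      · exact h2 c (hBA hcB)
      · exact h1 c (hBA hcB)
    rintro m (hm | ⟨u, hm⟩)
    · have := ReducedWord.base (τ := τ) (B := B) (q := q) A.one_mem hm
      rw [one_mul] at this
      exact Submodule.subset_span (Or.inr ⟨1, this⟩)
    · cases hm with
      | base hu hv =>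
        exact key _ hu _ (fun x hx => Submodule.subset_span (Or.inl (A.mul_mem hx hv)))
          (fun x hx => .base hx hv)
      | step hu hw hwc hm =>
        exact key _ hu _ (fun x hx => Submodule.subset_span (Or.inr ⟨_, hm.mul_left hx⟩))
          (fun x hx => .step hx hw hwc hm)
  exact h hy

/-- `B[p]⟨X⟩` is spanned by `B⟨X⟩` and the reduced words in `B⟨X⟩` and `p - τ(p)`. -/
theorem polyAlg_le_reducedSpan (hE : ∀ a, ∃ c, IsCondExp τ (B : Set R) a c) {X p : R} {α : ℂ}
    (hp : p * p = p) (hpB : ∀ b ∈ B, Commute p b) {x : R}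
    (hx : x ∈ polyAlg (Subalgebra.toSubmodule (Algebra.adjoin ℂ ((B : Set R) ∪ {p}))) X) :
    x ∈ reducedSpan τ B (Algebra.adjoin ℂ ((B : Set R) ∪ {X})) (p - α • 1) := by
  set A := Algebra.adjoin ℂ ((B : Set R) ∪ {X}) with hA
  have hBA : B ≤ A := fun b hb => Algebra.subset_adjoin (Or.inl hb)
  set S := reducedSpan τ B A (p - α • 1) with hS
  let T : Subalgebra ℂ R :=
    { carrier := {a | ∀ y ∈ S, a * y ∈ S}
      mul_mem' := fun {a b} ha hb y hy => by rw [mul_assoc]; exact ha _ (hb y hy)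
      add_mem' := fun {a b} ha hb y hy => by rw [add_mul]; exact S.add_mem (ha y hy) (hb y hy)
      algebraMap_mem' := fun r y hy => by rw [← Algebra.smul_def]; exact S.smul_mem r hy }
  have hAT : ∀ a ∈ A, a ∈ T := fun a ha y hy => mul_mem_reducedSpan ha hy
  have hqT : p - α • 1 ∈ T := fun y hy =>
    -- From `p² = p`: `(p - α)² = (1 - 2α)(p - α) + (α - α²)`.
    var_mul_mem_reducedSpan (β := 1 - 2 * α) (γ := α - α ^ 2) hE hBA
      (fun b hb => by rw [sub_mul, mul_sub, (hpB b hb).eq]; simp)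
      (by
        simp only [sub_mul, mul_sub, hp, smul_mul_assoc, mul_smul_comm, one_mul, mul_one,
          smul_sub, smul_smul]
        module) hy
  have hpT : p ∈ T := by
    have := T.add_mem hqT (T.smul_mem T.one_mem α)
    rwa [sub_add_cancel] at this
  have h1 : Algebra.adjoin ℂ ((B : Set R) ∪ {p}) ≤ T := by
    refine Algebra.adjoin_le ?_
    rintro y (hy | rfl)
    exacts [hAT y (hBA hy), hpT]
  have h2 : x ∈ T := by
    rw [mem_polyAlg_iff] at hx
    refine Algebra.adjoin_le (S := T) ?_ hx
    rintro y (hy | rfl)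
    exacts [h1 hy, hAT _ (Algebra.subset_adjoin (Or.inr rfl))]
  have h3 := h2 1 (Submodule.subset_span (Or.inl A.one_mem))
  rwa [mul_one] at h3

end Reduced

/-! ### The free difference quotient on reduced words -/

section DiffQuot

variable {R : Type*} [NormedRing R] [NormedAlgebra ℂ R]

theorem map_mem_span_tmul {S S' : Set (R × R)} (f g : R →ₗ[ℂ] R)
    (h : ∀ z ∈ S, (f z.1, g z.2) ∈ S') {t : R ⊗[ℂ] R}
    (ht : t ∈ Submodule.span ℂ ((fun z : R × R => z.1 ⊗ₜ[ℂ] z.2) '' S)) :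
    TensorProduct.map f g t ∈ Submodule.span ℂ ((fun z : R × R => z.1 ⊗ₜ[ℂ] z.2) '' S') := by
  have h1 : Submodule.span ℂ ((fun z : R × R => z.1 ⊗ₜ[ℂ] z.2) '' S) ≤
      (Submodule.span ℂ ((fun z : R × R => z.1 ⊗ₜ[ℂ] z.2) '' S')).comap
        (TensorProduct.map f g) := by
    refine Submodule.span_le.2 ?_
    rintro _ ⟨z, hz, rfl⟩
    exact Submodule.subset_span ⟨_, h z hz, rfl⟩
  exact h1 ht

variable {τ : StrongDual ℂ R} {B C : Subalgebra ℂ R} {X q : R}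
  {D : polyAlg (Subalgebra.toSubmodule B) X →ₗ[ℂ]
    polyAlg (Subalgebra.toSubmodule B) X ⊗[ℂ] polyAlg (Subalgebra.toSubmodule B) X}
  {D' : polyAlg (Subalgebra.toSubmodule C) X →ₗ[ℂ]
    polyAlg (Subalgebra.toSubmodule C) X ⊗[ℂ] polyAlg (Subalgebra.toSubmodule C) X}

namespace IsFreeDifferenceQuotient

/-- Enlarging the coefficients does not change the free difference quotient. -/
theorem tensorIncl_eq (hD : IsFreeDifferenceQuotient 1 (Subalgebra.toSubmodule B) X D)
    (hD' : IsFreeDifferenceQuotient 1 (Subalgebra.toSubmodule C) X D') (hBC : B ≤ C) {m : R}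
    (hm : m ∈ polyAlg (Subalgebra.toSubmodule B) X) :
    ∃ hm' : m ∈ polyAlg (Subalgebra.toSubmodule C) X,
      tensorIncl _ (D' ⟨m, hm'⟩) = tensorIncl _ (D ⟨m, hm⟩) := by
  obtain ⟨he, h1⟩ := hD'.map_var
  obtain ⟨hm', h2⟩ := hD.tensorIncl_eq_smul hD' (c := 1)
    (fun b hb => hBC hb) (var_mem_polyAlg _ X) (by rw [h1, one_smul]; rfl) hm
  exact ⟨hm', by rw [h2, one_smul]⟩

theorem tensorIncl_mem_span (P : NonUnitalSubalgebra ℂ R) (t : P ⊗[ℂ] P) :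
    tensorIncl P t ∈ Submodule.span ℂ
      ((fun z : R × R => z.1 ⊗ₜ[ℂ] z.2) '' {z | z.1 ∈ P ∧ z.2 ∈ P}) := by
  induction t with
  | zero => simp
  | add x y hx hy => rw [map_add]; exact add_mem hx hy
  | tmul x y => exact Submodule.subset_span ⟨(x, y), ⟨x.2, y.2⟩, rfl⟩

/-- The free difference quotient of a reduced word is a sum of tensors one of whose legs is a
reduced word. -/
theorem mem_span_of_reducedWord
    (hD : IsFreeDifferenceQuotient 1 (Subalgebra.toSubmodule B) X D)
    (hD' : IsFreeDifferenceQuotient 1 (Subalgebra.toSubmodule C) X D') (hBC : B ≤ C) (hq : q ∈ C)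
    {u m : R} (h : ReducedWord τ (B : Set R) (Algebra.adjoin ℂ ((B : Set R) ∪ {X})) q u m) :
    ∃ hm : m ∈ polyAlg (Subalgebra.toSubmodule C) X, tensorIncl _ (D' ⟨m, hm⟩) ∈
      Submodule.span ℂ ((fun z : R × R => z.1 ⊗ₜ[ℂ] z.2) '' {z |
        (∃ u', ReducedWord τ (B : Set R) (Algebra.adjoin ℂ ((B : Set R) ∪ {X})) q u' z.2) ∨
          ReducedWord τ (B : Set R) (Algebra.adjoin ℂ ((B : Set R) ∪ {X})) q u z.1}) := by
  set A := Algebra.adjoin ℂ ((B : Set R) ∪ {X}) with hA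
  -- On letters from `B⟨X⟩` the derivation over the larger `C` still has both legs in `B⟨X⟩`.
  have hδ : ∀ x ∈ A, ∃ hx : x ∈ polyAlg (Subalgebra.toSubmodule C) X,
      tensorIncl _ (D' ⟨x, hx⟩) ∈ Submodule.span ℂ
        ((fun z : R × R => z.1 ⊗ₜ[ℂ] z.2) '' {z | z.1 ∈ A ∧ z.2 ∈ A}) := by
    intro x hx
    obtain ⟨hx', h1⟩ := hD.tensorIncl_eq hD' hBC (mem_polyAlg_iff.2 hx)
    refine ⟨hx', ?_⟩
    rw [h1]
    refine Submodule.span_mono (Set.image_mono ?_) (tensorIncl_mem_span _ _)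
    rintro z ⟨h2, h3⟩
    exact ⟨mem_polyAlg_iff.1 h2, mem_polyAlg_iff.1 h3⟩
  have hqP : q ∈ polyAlg (Subalgebra.toSubmodule C) X := coeff_mem_polyAlg hq
  have hmul : ∀ {x y} (hx : x ∈ polyAlg (Subalgebra.toSubmodule C) X)
      (hy : y ∈ polyAlg (Subalgebra.toSubmodule C) X),
      tensorIncl _ (D' ⟨x * q * y, mul_mem (mul_mem hx hqP) hy⟩) =
        TensorProduct.map LinearMap.id (LinearMap.mulRight ℂ (q * y)) (tensorIncl _ (D' ⟨x, hx⟩)) +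
        TensorProduct.map (LinearMap.mulLeft ℂ (x * q)) LinearMap.id
          (tensorIncl _ (D' ⟨y, hy⟩)) := by
    intro x y hx hy
    have h1 := hD'.tensorIncl_mul (⟨x, hx⟩ * ⟨q, hqP⟩) ⟨y, hy⟩
    have h2 := hD'.tensorIncl_mul ⟨x, hx⟩ ⟨q, hqP⟩
    rw [hD'.map_coeff q hq, map_zero, map_zero, add_zero] at h2
    rw [h2] at h1
    refine h1.trans ?_
    congr 1
    rw [← LinearMap.comp_apply, ← LinearMap.lTensor_comp, ← LinearMap.mulRight_mul]
    rfl
  induction h with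
  | @base u v hu hv =>
    obtain ⟨hu', h1⟩ := hδ u hu
    obtain ⟨hv', h2⟩ := hδ v hv
    refine ⟨mul_mem (mul_mem hu' hqP) hv', ?_⟩
    rw [hmul hu' hv']
    -- Cutting `u` leaves a reduced word on the right; cutting `v` leaves one on the left.
    refine add_mem (map_mem_span_tmul _ _ ?_ h1) (map_mem_span_tmul _ _ ?_ h2)
    · rintro z ⟨-, hz⟩
      refine Or.inl ⟨z.2, ?_⟩
      rw [LinearMap.mulRight_apply, ← mul_assoc]
      exact .base hz hv
    · rintro z ⟨hz, -⟩
      exact Or.inr (.base hu hz)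
  | @step u w m hu hw hwc hm ih =>
    obtain ⟨hu', h1⟩ := hδ u hu
    obtain ⟨hm', h2⟩ := ih
    refine ⟨mul_mem (mul_mem hu' hqP) hm', ?_⟩
    rw [hmul hu' hm']
    refine add_mem (map_mem_span_tmul _ _ ?_ h1) (map_mem_span_tmul _ _ ?_ h2)
    · rintro z ⟨-, hz⟩
      refine Or.inl ⟨z.2, ?_⟩
      rw [LinearMap.mulRight_apply, ← mul_assoc]
      exact .step hz hw hwc hm
    -- A reduced left leg of the tail still begins with the centred letter `w`, so it may be
    -- prefixed by `u q`. This is why the first letter is recorded in `ReducedWord`.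
    · rintro z (hz | hz)
      · exact Or.inl hz
      · exact Or.inr (.step hu hw hwc hz)

end IsFreeDifferenceQuotient

/-- If `X` and `p` are `B`-free, the conjugate variable relation of `X` over `B` extends from
`B⟨X⟩` to `B[p]⟨X⟩`. -/
theorem apply_eq_tensorFunctional (htr : ∀ x y, τ (x * y) = τ (y * x))
    (hE : ∀ a, ∃ c, IsCondExp τ (B : Set R) a c) {p : R}
    (hp : p * p = p) (hpB : ∀ b ∈ B, Commute p b)
    (hfree : FreeElementsOver τ (B : Set R) X p)
    (hqc : IsCondExp τ (B : Set R) (p - τ p • 1) 0)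
    (hC : C = Algebra.adjoin ℂ ((B : Set R) ∪ {p}))
    {J : StrongDual ℂ (corner (1 : R))}
    (hJ : J ∈ L1 τ 1 (polyAlg (Subalgebra.toSubmodule B) X : Set R))
    (hD : IsFreeDifferenceQuotient 1 (Subalgebra.toSubmodule B) X D)
    (hJD : ∀ m : polyAlg (Subalgebra.toSubmodule B) X, J ⟨m, mem_corner_one _⟩ =
      tensorFunctional (τ : R →ₗ[ℂ] ℂ) (tensorIncl _ (D m)))
    (hD' : IsFreeDifferenceQuotient 1 (Subalgebra.toSubmodule C) X D')
    (m : polyAlg (Subalgebra.toSubmodule C) X) :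
    J ⟨m, mem_corner_one _⟩ = tensorFunctional (τ : R →ₗ[ℂ] ℂ) (tensorIncl _ (D' m)) := by
  set A := Algebra.adjoin ℂ ((B : Set R) ∪ {X}) with hA
  have hBA : B ≤ A := fun b hb => Algebra.subset_adjoin (Or.inl hb)
  have hBC : B ≤ C := hC ▸ fun b hb => Algebra.subset_adjoin (Or.inl hb)
  have hq : p - τ p • 1 ∈ C := hC ▸
    sub_mem (Algebra.subset_adjoin (Or.inr rfl)) (Subalgebra.smul_mem _ (one_mem _) _)
  have hzero : ∀ {u m}, ReducedWord τ (B : Set R) A (p - τ p • 1) u m → τ m = 0 := fun h =>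
    h.apply_eq_zero htr hE hBA hfree (hC ▸ hq) hqc
  have hδ0 : ∀ {u m}, ReducedWord τ (B : Set R) A (p - τ p • 1) u m →
      ∃ hm : m ∈ polyAlg (Subalgebra.toSubmodule C) X,
        tensorFunctional (τ : R →ₗ[ℂ] ℂ) (tensorIncl _ (D' ⟨m, hm⟩)) = 0 := by
    intro u m h
    obtain ⟨hm, h2⟩ := hD.mem_span_of_reducedWord hD' hBC hq h
    refine ⟨hm, ?_⟩
    refine Submodule.span_le (p := LinearMap.ker (tensorFunctional (τ : R →ₗ[ℂ] ℂ))).2 ?_ h2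
    rintro _ ⟨z, ⟨u', hz⟩ | hz, rfl⟩
    · exact mul_eq_zero_of_right _ (hzero hz)
    · exact mul_eq_zero_of_left (hzero hz) _
  -- For `x` in `B⟨X⟩` near `J` in `L¹`, the product `x m` is again a reduced word, so `τ(x m) = 0`.
  have hJ0 : ∀ {u m}, ReducedWord τ (B : Set R) A (p - τ p • 1) u m →
      J ⟨m, mem_corner_one m⟩ = 0 := by
    intro u m h
    refine norm_le_zero_iff.1 (le_of_forall_pos_le_add fun ε hε => ?_)
    obtain ⟨_, ⟨x, hx, rfl⟩, h2⟩ := mem_closure_dual_iff.1 hJ (ε / (‖m‖ + 1)) (by positivity)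
    have h3 := h2 ⟨m, mem_corner_one m⟩
    rw [toL1_apply, hzero (h.mul_left (mem_polyAlg_iff.1 hx)), mul_zero, sub_zero] at h3
    refine h3.trans ?_
    rw [zero_add, div_mul_eq_mul_div, div_le_iff₀ (by positivity)]
    have : ‖(⟨m, mem_corner_one m⟩ : corner (1 : R))‖ = ‖m‖ := rfl
    rw [this]
    nlinarith
  obtain ⟨m, hm⟩ := m
  let F : polyAlg (Subalgebra.toSubmodule C) X →ₗ[ℂ] ℂ :=
    (J : corner (1 : R) →ₗ[ℂ] ℂ) ∘ₗ LinearMap.codRestrict (corner 1)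
      (polyAlg (Subalgebra.toSubmodule C) X).toSubmodule.subtype (fun x => mem_corner_one x.1) -
    tensorFunctional (τ : R →ₗ[ℂ] ℂ) ∘ₗ tensorIncl _ ∘ₗ D'
  have hle : reducedSpan τ (B : Set R) A (p - τ p • 1) ≤
      (LinearMap.ker F).map (polyAlg (Subalgebra.toSubmodule C) X).toSubmodule.subtype := by
    refine Submodule.span_le.2 ?_
    rintro x (hx | ⟨u, hx⟩)
    · obtain ⟨hx', h2⟩ := hD.tensorIncl_eq hD' hBC (mem_polyAlg_iff.2 hx)
      refine ⟨⟨x, hx'⟩, sub_eq_zero.2 ?_, rfl⟩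
      exact (hJD ⟨x, mem_polyAlg_iff.2 hx⟩).trans (congrArg _ h2.symm)
    · obtain ⟨hx', h2⟩ := hδ0 hx
      exact ⟨⟨x, hx'⟩, sub_eq_zero.2 ((hJ0 hx).trans h2.symm), rfl⟩
  obtain ⟨y, hy, hym⟩ := hle (polyAlg_le_reducedSpan hE hp hpB (hC ▸ hm))
  obtain rfl : y = ⟨m, hm⟩ := Subtype.ext hym
  exact sub_eq_zero.1 hy

end DiffQuot

/-! ### Conjugate variables of compressions -/

section CompressionData

variable {R : Type*} [Ring R] [Algebra ℂ R]

/-- `B⟨X⟩` as a `*`-algebra, for self-adjoint `B` and `X`. -/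
def polyStarAlg [StarRing R] [StarModule ℂ R] (B : Submodule ℂ R) (X : R)
    (hB : ∀ b ∈ B, star b ∈ B) (hX : star X = X) : NonUnitalStarSubalgebra ℂ R where
  __ := polyAlg B X
  star_mem' := by
    intro a ha
    change a ∈ polyAlg B X at ha
    change star a ∈ polyAlg B X
    induction ha using NonUnitalAlgebra.adjoin_induction with
    | mem y hy =>
      rcases hy with hy | rfl
      · exact coeff_mem_polyAlg (hB y hy)
      · rw [hX]; exact var_mem_polyAlg B y
    | add y z _ _ h1 h2 => rw [star_add]; exact add_mem h1 h2
    | zero => rw [star_zero]; exact zero_mem _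
    | mul y z _ _ h1 h2 => rw [star_mul]; exact mul_mem h2 h1
    | smul c y _ h1 => rw [star_smul]; exact SMulMemClass.smul_mem _ h1

theorem mem_corner_of_mul_mul {p x : R} (h : p * x * p = x) : x ∈ corner p :=
  ⟨x, by simpa [mul_assoc] using h⟩

/-- On `Bp⟨X_p⟩` the free difference quotients of `c p X p` and of `X` agree up to the factor
`c`. -/
theorem IsFreeDifferenceQuotient.tensorIncl_compression {B C : Submodule ℂ R} {X p : R} {c : ℂ}
    (hBC : B ≤ C) (hp : p ∈ C)
    {D : polyAlg B (c • (p * X * p)) →ₗ[ℂ]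
      polyAlg B (c • (p * X * p)) ⊗[ℂ] polyAlg B (c • (p * X * p))}
    {D' : polyAlg C X →ₗ[ℂ] polyAlg C X ⊗[ℂ] polyAlg C X}
    (hD : IsFreeDifferenceQuotient p B (c • (p * X * p)) D)
    (hD' : IsFreeDifferenceQuotient 1 C X D') {m : R} (hm : m ∈ polyAlg B (c • (p * X * p))) :
    ∃ hm' : m ∈ polyAlg C X,
      tensorIncl _ (D' ⟨m, hm'⟩) = c • tensorIncl _ (D ⟨m, hm⟩) := by
  have hpP : p ∈ polyAlg C X := coeff_mem_polyAlg hp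
  have hXP : X ∈ polyAlg C X := var_mem_polyAlg C X
  have hpX : p * X * p ∈ polyAlg C X := mul_mem (mul_mem hpP hXP) hpP
  refine hD.tensorIncl_eq_smul hD' hBC (SMulMemClass.smul_mem c hpX) ?_ hm
  obtain ⟨he, hvar⟩ := hD'.map_var
  have e1 := hD'.tensorIncl_mul (⟨p, hpP⟩ * ⟨X, hXP⟩) ⟨p, hpP⟩
  have e2 := hD'.tensorIncl_mul ⟨p, hpP⟩ ⟨X, hXP⟩
  rw [hD'.map_coeff p hp, map_zero, map_zero, zero_add, hvar, tensorIncl_tmul,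
    LinearMap.rTensor_tmul, LinearMap.mulLeft_apply, mul_one] at e2
  rw [hD'.map_coeff p hp, map_zero, map_zero, add_zero, e2, LinearMap.lTensor_tmul,
    LinearMap.mulRight_apply, one_mul] at e1
  have e3 := (tensorIncl _ ∘ₗ D').map_smul c ⟨p * X * p, hpX⟩
  exact e3.trans (congrArg (c • ·) e1)

end CompressionData

/-! ### Centring of `p` and normalization of the corner trace -/

section Centring

variable {R : Type*} [NormedRing R] [NormedAlgebra ℂ R]

/-- Independence says `τ(p b) = τ(p) τ(b)`, that is, `E_B(p) = τ(p)`. -/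
theorem isCondExp_sub_of_independent {τ : StrongDual ℂ R} {B : Subalgebra ℂ R} {p : R}
    (h : IndependentFrom τ p (B : Set R)) : IsCondExp τ (B : Set R) (p - τ p • 1) 0 :=
  isCondExp_zero_iff.2 fun b hb => by
    rw [sub_mul, map_sub, (h p (Algebra.subset_adjoin rfl) b hb).2, smul_mul_assoc,
      one_mul, map_smul, smul_eq_mul, sub_self]

theorem tensorSquare_cornerTrace (τ : StrongDual ℂ R) (p : R) (P : NonUnitalSubalgebra ℂ R)
    (t : P ⊗[ℂ] P) : tensorSquare (cornerTrace τ p : R →ₗ[ℂ] ℂ) P t =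
      (τ p)⁻¹ * ((τ p)⁻¹ * tensorFunctional (τ : R →ₗ[ℂ] ℂ) (tensorIncl P t)) := by
  rw [tensorSquare_eq]
  generalize tensorIncl P t = t
  induction t with
  | zero => simp
  | add x y hx hy => rw [map_add, map_add, hx, hy]; ring
  | tmul x y =>
    simp [cornerTrace]
    ring

theorem tensorSquare_cornerTrace_one {τ : StrongDual ℂ R} (h : τ 1 = 1)
    (P : NonUnitalSubalgebra ℂ R) (t : P ⊗[ℂ] P) :
    tensorSquare (cornerTrace τ 1 : R →ₗ[ℂ] ℂ) P t =
      tensorFunctional (τ : R →ₗ[ℂ] ℂ) (tensorIncl P t) := by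
  rw [tensorSquare_cornerTrace, h, inv_one, one_mul, one_mul]

end Centring

end

end FreeProb


/-! ### The conjugate variable of the compression -/

set_option maxHeartbeats 4000000 in
theorem mainTheorem6 {H : Type*} [NormedAddCommGroup H] [InnerProductSpace ℂ H] [CompleteSpace H]
    (M : VonNeumannAlgebra H) (τ : StrongDual ℂ M.toStarSubalgebra)
    (hτ : FreeProb.IsFaithfulNormalTraceState M τ)
    (B : StarSubalgebra ℂ M.toStarSubalgebra)
    (hB : FreeProb.wStar M (B : Set M.toStarSubalgebra) ⊆ B)
    (X p : M.toStarSubalgebra) (hX : IsSelfAdjoint X) (hp : IsStarProjection p) (hp0 : p ≠ 0)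
    (hpB : ∀ b ∈ B, Commute p b)
    (hfree : FreeProb.AlgebraicallyFree
      (Subalgebra.toSubmodule (Algebra.adjoin ℂ ((B : Set M.toStarSubalgebra) ∪ {p}))) X)
    (hindep : FreeProb.IndependentFrom τ p (B : Set M.toStarSubalgebra))
    (hBfree : FreeProb.FreeElementsOver τ (B : Set M.toStarSubalgebra) X p)
    (J : StrongDual ℂ (FreeProb.corner (1 : M.toStarSubalgebra)))
    (hJ : FreeProb.IsConjugateVariable M τ 1 (Subalgebra.toSubmodule B.toSubalgebra) X J) :
    let Bp := FreeProb.rightMul (Subalgebra.toSubmodule B.toSubalgebra) p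
    let Xp := (τ p)⁻¹ • (p * X * p)
    ∃ Jp : StrongDual ℂ (FreeProb.corner p),
      FreeProb.IsConjugateVariable M τ p Bp Xp Jp ∧
      (∀ J' : StrongDual ℂ (FreeProb.corner p),
        FreeProb.IsConjugateVariable M τ p Bp Xp J' → J' = Jp) ∧
      FreeProb.IsCondExpL1 τ p
        (FreeProb.wStar M (FreeProb.polyAlg Bp Xp : Set M.toStarSubalgebra))
        (FreeProb.compressL1 τ p J) Jp := by
  intro Bp Xp
  have hτ' := hτ.isTraceState
  have hpp : p * p = p := hp.isIdempotentElem
  have hps : star p = p := hp.isSelfAdjoint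
  have hα : τ p ≠ 0 := fun h0 => hp0 (hτ.faithful p (by rw [hps, hpp, h0]))
  have hαs : star (τ p) = τ p := by rw [← hτ'.map_star, hps]
  -- the coefficient algebras
  set C := Algebra.adjoin ℂ ((B : Set M.toStarSubalgebra) ∪ {p}) with hC
  have hpC : p ∈ Subalgebra.toSubmodule C := Algebra.subset_adjoin (Or.inr rfl)
  have hBpC : Bp ≤ Subalgebra.toSubmodule C := by
    rintro _ ⟨b, hb, rfl⟩
    exact C.mul_mem (Algebra.subset_adjoin (Or.inl hb)) hpC
  have hpBp : p ∈ Bp := ⟨1, B.one_mem, one_mul p⟩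
  have hl : ∀ b ∈ Bp, p * b = b := by
    rintro _ ⟨b, hb, rfl⟩
    simp only [LinearMap.mulRight_apply]
    rw [← mul_assoc, (hpB b hb).eq, mul_assoc, hpp]
  have hr : ∀ b ∈ Bp, b * p = b := by
    rintro _ ⟨b, hb, rfl⟩
    simp only [LinearMap.mulRight_apply]
    rw [mul_assoc, hpp]
  have hmul : ∀ a ∈ Bp, ∀ b ∈ Bp, a * b ∈ Bp := by
    rintro a ha _ ⟨b, hb, rfl⟩
    obtain ⟨a, ha', rfl⟩ := ha
    refine ⟨a * b, B.mul_mem ha' hb, ?_⟩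
    simp only [LinearMap.mulRight_apply]
    rw [mul_assoc a p, ← mul_assoc p b, (hpB b hb).eq, mul_assoc b, hpp, mul_assoc]
  have hstar : ∀ b ∈ Bp, star b ∈ Bp := by
    rintro _ ⟨b, hb, rfl⟩
    refine ⟨star b, B.star_mem' hb, ?_⟩
    simp only [LinearMap.mulRight_apply]
    rw [star_mul, hps, (hpB _ (B.star_mem' hb)).eq]
  have hlX : p * Xp = Xp := by
    simp only [Xp, mul_smul_comm, ← mul_assoc, hpp]
  have hrX : Xp * p = Xp := by
    simp only [Xp, smul_mul_assoc, mul_assoc, hpp]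
  have hXp : star Xp = Xp := by
    simp only [Xp, star_smul, star_mul, hps, hX.star_eq, star_inv₀, hαs, mul_assoc]
  -- the free difference quotients
  obtain ⟨D, hD, hJD⟩ := hJ.eq_diffQuot
  have hfreep : FreeProb.AlgebraicallyFree Bp Xp :=
    hfree.compression hBpC (inv_ne_zero hα) hl hr
  obtain ⟨Dp, hDp⟩ := FreeProb.exists_isFreeDifferenceQuotient hpBp hmul hl hr hlX hrX hfreep
  obtain ⟨D', hD'⟩ := FreeProb.exists_isFreeDifferenceQuotient (e := 1) C.one_mem
    (fun a ha b hb => C.mul_mem ha hb) (fun b _ => one_mul b) (fun b _ => mul_one b)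
    (one_mul X) (mul_one X) hfree
  -- the conjugate variable relation on `B[p]⟨X⟩`
  have hq : FreeProb.IsCondExp τ (B.toSubalgebra : Set M.toStarSubalgebra) (p - τ p • 1) 0 :=
    FreeProb.isCondExp_sub_of_independent (B := B.toSubalgebra) hindep
  have hE : ∀ a, ∃ c, FreeProb.IsCondExp τ (B.toSubalgebra : Set M.toStarSubalgebra) a c :=
    FreeProb.exists_isCondExp hτ B.toNonUnitalStarSubalgebra hB
  have hJ1 : J ∈ FreeProb.L1 τ 1 (FreeProb.polyAlg (Subalgebra.toSubmodule B.toSubalgebra) X :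
      Set M.toStarSubalgebra) :=
    FreeProb.L1_wStar_subset hτ (FreeProb.polyStarAlg (Subalgebra.toSubmodule B.toSubalgebra) X
      (fun b hb => B.star_mem' hb) hX) (e := 1) (FreeProb.coeff_mem_polyAlg B.one_mem)
      (fun a _ => one_mul a) (fun a _ => mul_one a) 1 hJ.mem_L1
  have hJB : ∀ m : FreeProb.polyAlg (Subalgebra.toSubmodule B.toSubalgebra) X,
      J ⟨m, FreeProb.mem_corner_one _⟩ =
        FreeProb.tensorFunctional (τ : M.toStarSubalgebra →ₗ[ℂ] ℂ)
          (FreeProb.tensorIncl _ (D m)) := by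
    intro m
    obtain ⟨hm, h⟩ := hJD m
    exact h.trans (FreeProb.tensorSquare_cornerTrace_one hτ.map_one _ _)
  have hBfree' : FreeProb.FreeElementsOver τ (B.toSubalgebra : Set M.toStarSubalgebra) X p := hBfree
  have hJC := FreeProb.apply_eq_tensorFunctional hτ.trace hE hpp hpB hBfree' hq hC hJ1 hD hJB hD'
  -- the generated algebras
  let P := FreeProb.polyStarAlg Bp Xp hstar hXp
  have hlP : ∀ a ∈ P, p * a = a := fun a ha => FreeProb.polyAlg_unit_mul hl hlX ha
  have hrP : ∀ a ∈ P, a * p = a := fun a ha => FreeProb.polyAlg_mul_unit hr hrX ha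
  have hP : ∀ n ∈ P, n ∈ FreeProb.corner p := fun n hn =>
    FreeProb.mem_corner_of_mul_mul (by rw [hlP n hn, hrP n hn])
  have hN : ∀ n ∈ FreeProb.wStarAlg M P, n ∈ FreeProb.corner p := fun n hn =>
    FreeProb.mem_corner_of_mul_mul (FreeProb.mul_mul_eq_of_mem_wStar
      (fun a ha => by rw [hlP a ha, hrP a ha]) hn)
  have hJcomp : FreeProb.compressL1 τ p J ∈ FreeProb.L1 τ p (Set.univ : Set M.toStarSubalgebra) := by
    refine map_mem_closure (FreeProb.continuous_compressL1 τ p) hJ.mem_L1 ?_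
    rintro _ ⟨x, -, rfl⟩
    exact ⟨_, trivial, (FreeProb.compressL1_toL1 τ hτ.map_one hτ.trace p x hpp).symm⟩
  obtain ⟨Jp, hJp, hJpn⟩ := hτ'.exists_condExp_L1 (FreeProb.wStarAlg M P) hN hJcomp
  -- One factor `(τ p)⁻¹` comes from normalizing the trace in `compressL1`, the other from `∂_X X_p
  -- = (τ p)⁻¹ p ⊗ p`; together they match the two normalizations in `τ_p ⊗ τ_p`.
  have hval : ∀ m (hm : m ∈ P), FreeProb.compressL1 τ p J ⟨m, hP m hm⟩ =
      FreeProb.tensorSquare (FreeProb.cornerTrace τ p : M.toStarSubalgebra →ₗ[ℂ] ℂ)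
        (FreeProb.polyAlg Bp Xp) (Dp ⟨m, hm⟩) := by
    intro m hm
    obtain ⟨hm', h1⟩ := hDp.tensorIncl_compression hBpC hpC hD' hm
    have h2 := hJC ⟨m, hm'⟩
    rw [h1, map_smul] at h2
    have h3 : FreeProb.compressL1 τ p J ⟨m, hP m hm⟩ =
      (τ p)⁻¹ * J ⟨m, FreeProb.mem_corner_one m⟩ := rfl
    rw [h3, h2]
    exact (FreeProb.tensorSquare_cornerTrace τ p _ _).symm
  refine ⟨Jp, ⟨hfreep, hJp, Dp, hDp, fun m => ⟨hP m m.2, ?_⟩⟩, fun J' hJ' => ?_, hJp,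
    fun n hn => ⟨hN n hn, hJpn n hn⟩⟩
  · exact (hJpn m (FreeProb.subset_wStar _ m.2)).trans (hval m m.2)
  -- Uniqueness: both candidates lie in `L¹(P)`, where values on `P` are decisive, and those values
  -- are prescribed by the unique difference quotient.
  · have hsub := FreeProb.L1_wStar_subset hτ P (FreeProb.coeff_mem_polyAlg hpBp) hlP hrP p
    refine hτ'.eq_of_mem_L1 P hP (hsub hJ'.mem_L1) (hsub hJp) fun n hn => ?_
    obtain ⟨D₂, hD₂, h2⟩ := hJ'.eq_diffQuot
    obtain ⟨_, h3⟩ := h2 ⟨n, hn⟩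
    rw [hJpn n (FreeProb.subset_wStar _ hn), hval n hn, hDp.unique hD₂]
    exact h3
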